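/- Time is slotted. An $M\times M$ crossbar switch is a bufferless element with $M$ input links and $M$ output links which in each time slot can be set to realize any of the $M!$ permutations between its inputs and outputs. A fiber delay line with delay $d$ (a non-negative integer) has one input link and one output link, and a packet needs $d$ slots to traverse it. Each link carries at most one packet per slot. A priority queue with buffer $B$ is a network element with one input link, a controller that may send a departure request in each slot, a departure link and a loss link. Each arriving packet has a priority, and the priorities of different packets are distinct. For slot $t$, let $a(t),d(t),l(t)\in\{0,1\}$ be the numbers of packets on the input, departure and loss links, let $c(t)=1$ if there is a departure request and $c(t)=0$ otherwise, and let $q(t)$ be the number of packets in the queue at the end of slot $t$. Let $r_i(t)$ be the rank of packet $i$ (rank $1$ being the highest priority) among the packets in the queue at the beginning of slot $t$ and the packet arriving in slot $t$, if any. The element is required to satisfy, for every $t$: 1. $q(t)=q(t-1)+a(t)-d(t)-l(t)$; 2. $d(t)=1$ if $c(t)=1$ and $q(t-1)+a(t)>0$, and $d(t)=0$ otherwise; 3. $l(t)=1$ if $c(t)=0$, $q(t-1)=B$ and $a(t)=1$, and $l(t)=0$ otherwise; moreover $l(t)=\max(q(t-1)+a(t)-d(t)-B,\,0)$; 4. if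 packet $i$ departs in slot $t$, then $r_i(t)=1$; 5. if packet $i$ is lost in slot $t$, then $r_i(t)=B+1$. **Theorem.** Let $m\ge 1$ be an integer. A priority queue with buffer $B=3\times 2^{m-1}-2$ can be constructed with one $(32m-14)\times(32m-14)$ crossbar switch, forty-eight $3\times 3$ switches, twenty-four $(j+1)\times(j+1)$ switches for each $j=3,\dots,m-1$, twelve $(m+1)\times(m+1)$ switches, and $12(m^2-2m+3)$ fiber delay lines. That is, the delays of the lines can be chosen and these parts can be connected by links (each link joining an output of a part, or the external input link, to an input of a part, or to the departure or loss link; some inputs and outputs may stay unconnected) into a network which, starting empty, is a priority queue with buffer $B$ for all sequences of arrivals, priorities and departure requests, under a routing policy that sets the switches in slot $t$ knowing only the arrivals, priorities and requests up to and including slot $t$. The packets in the queue are those inside the delay lines. -/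

import Mathlib

universe u

/-! ## Priority queues as network elements

Time is slotted, with slots `0, 1, 2, …`. At most one packet is on the input link in a slot, so a
packet is identified by the slot in which it arrives. -/

/-- What is seen on the links of a one-input, two-output queueing element.
* `arrival t = some x`: a packet (named `t`) of priority `x` arrives in slot `t`;
* `request t`: the controller sends a departure request in slot `t`;
* `departure t`, `loss t`: the packet on the departure link and on the loss link in slot `t`;
* `stored t`: the packets in the queue at the beginning of slot `t` (so `stored (t + 1)` are the
  packets in the queue at the end of slot `t`). -/
structure QueueTrace (α : Type u) where
  arrival : ℕ → Option α
  request : ℕ → Bool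
  departure : ℕ → Option ℕ
  loss : ℕ → Option ℕ
  stored : ℕ → Set ℕ

/-- The 0-1 state of a link that carries the given packet, if any. -/
def linkState {β : Type u} (x : Option β) : ℤ := if x.isSome then 1 else 0

namespace QueueTrace

variable {α : Type u} (T : QueueTrace α)

/-- The number of packets in the queue at the beginning of slot `t`. -/
noncomputable def q (t : ℕ) : ℤ := ((T.stored t).ncard : ℤ)

/-- State of the input link. -/
def a (t : ℕ) : ℤ := linkState (T.arrival t)

/-- State of the departure link. -/
def d (t : ℕ) : ℤ := linkState (T.departure t)

/-- State of the loss link. -/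
def l (t : ℕ) : ℤ := linkState (T.loss t)

/-- The packets buffered in the queue together with the packet arriving in slot `t` (if any). -/
def present (t : ℕ) : Set ℕ :=
  T.stored t ∪ {i | i = t ∧ (T.arrival t).isSome}

/-- Packet `k` has at least the priority of packet `i` (larger values of `α` mean higher
priority). -/
def AtLeast [LinearOrder α] (k i : ℕ) : Prop :=
  ∃ x y, T.arrival k = some x ∧ T.arrival i = some y ∧ y ≤ x

/-- The priority order `r_i(t)`: it is `j` if `i` has the `j`-th highest priority among the packets
present in slot `t` (whose priorities are distinct). -/
noncomputable def rank [LinearOrder α] (t i : ℕ) : ℕ :=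
  {k | k ∈ T.present t ∧ T.AtLeast k i}.ncard

/-- The defining properties of a priority queue with buffer `B`. In slot `t` the number of packets
in the queue changes from `q t` to `q (t + 1)`. -/
structure IsPriorityQueue [LinearOrder α] (B : ℕ) : Prop where
  flow_conservation : ∀ t, T.q (t + 1) = T.q t + T.a t - T.d t - T.l t
  non_idling : ∀ t, T.d t = if T.request t = true ∧ 0 < T.q t + T.a t then 1 else 0
  maximum_buffer_usage : ∀ t,
    T.l t = if T.request t = false ∧ T.q t = B ∧ T.a t = 1 then 1 else 0
  loss_only_when_full : ∀ t, T.l t = max (T.q t + T.a t - T.d t - B) 0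
  priority_departure : ∀ t i, T.departure t = some i → i ∈ T.present t ∧ T.rank t i = 1
  priority_loss : ∀ t i, T.loss t = some i → i ∈ T.present t ∧ T.rank t i = B + 1

end QueueTrace

/-! ## Networks of crossbar switches and fiber delay lines -/

/-- The places from which packets emerge: the external input link, the outputs of the switches and
the outputs of the delay lines. -/
inductive Outlet (S : Type) (size : S → ℕ) (L : Type) : Type
  | input : Outlet S size L
  | ofSwitch (k : S) (i : Fin (size k)) : Outlet S size L
  | ofLine (e : L) : Outlet S size L

/-- The places into which packets are sent: the external departure link and loss link, the inputs
of the switches and the inputs of the delay lines. -/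
inductive Inlet (S : Type) (size : S → ℕ) (L : Type) : Type
  | departure : Inlet S size L
  | loss : Inlet S size L
  | toSwitch (k : S) (i : Fin (size k)) : Inlet S size L
  | toLine (e : L) : Inlet S size L

/-- A network made of finitely many crossbar switches (`k` is a `size k × size k` switch) and
finitely many fiber delay lines (`e` has delay `delay e`), with one input link, one departure link
and one loss link. `wire y = some x` means that there is a link from outlet `x` to inlet `y`. A
link has one beginning and one end; inlets and outlets may be left unconnected. -/
structure SDLNetwork where
  Switch : Type
  Line : Type
  [fintypeSwitch : Fintype Switch]
  [fintypeLine : Fintype Line]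
  size : Switch → ℕ
  delay : Line → ℕ
  wire : Inlet Switch size Line → Option (Outlet Switch size Line)
  wire_inj : ∀ y y' x, wire y = some x → wire y' = some x → y = y'

namespace SDLNetwork

attribute [instance] SDLNetwork.fintypeSwitch SDLNetwork.fintypeLine

variable (N : SDLNetwork)

/-- The sizes of all switches of the network, with multiplicity. -/
def switchSizes : Multiset ℕ := (Finset.univ : Finset N.Switch).val.map N.size

/-- The number of fiber delay lines of the network. -/
def numLines : ℕ := Fintype.card N.Line

/-- A setting of all switches: each realizes a permutation between its inputs and outputs. -/
abbrev Setting : Type := ∀ k : N.Switch, Equiv.Perm (Fin (N.size k))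

/-- `N.At σ arr t x p`: in slot `t`, packet `p` is at outlet `x`, when the switches are set to `σ t`
in slot `t`, arrivals are given by `arr`, and all delay lines are empty at the beginning. Switches
and links are traversed within the slot; a delay line with delay `d` takes `d` slots. -/
inductive At {α : Type u} (σ : ℕ → N.Setting) (arr : ℕ → Option α) :
    ℕ → Outlet N.Switch N.size N.Line → ℕ → Prop
  | arrival (t : ℕ) : (arr t).isSome → At σ arr t .input t
  | switch (t p : ℕ) (k : N.Switch) (i : Fin (N.size k)) (x : Outlet N.Switch N.size N.Line) :
      N.wire (.toSwitch k i) = some x → At σ arr t x p → At σ arr t (.ofSwitch k (σ t k i)) p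
  | line (t p : ℕ) (e : N.Line) (x : Outlet N.Switch N.size N.Line) :
      N.wire (.toLine e) = some x → At σ arr t x p → At σ arr (t + N.delay e) (.ofLine e) p

variable {N} {α : Type u} {σ : ℕ → N.Setting} {arr : ℕ → Option α}

theorem At.le {t p : ℕ} {x : Outlet N.Switch N.size N.Line} (h : N.At σ arr t x p) : p ≤ t := by
  induction h with
  | arrival t _ => exact le_rfl
  | switch t p k i x _ _ ih => exact ih
  | line t p e x _ _ ih => omega

/-- There is at most one packet at a place in a slot. -/
theorem At.unique {t p p' : ℕ} {x : Outlet N.Switch N.size N.Line}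
    (h : N.At σ arr t x p) (h' : N.At σ arr t x p') : p = p' := by
  induction h generalizing p' with
  | arrival t _ => cases h'; rfl
  | switch t p k i x hw _ ih =>
    generalize hy : (Outlet.ofSwitch k (σ t k i) : Outlet N.Switch N.size N.Line) = y at h'
    cases h' with
    | arrival => cases hy
    | switch t p' k' i' x' hw' hx' =>
      injection hy with hk hi
      subst hk
      have hi' := (σ t k).injective (eq_of_heq hi)
      subst hi'
      rw [hw] at hw'
      cases hw'
      exact ih hx'
    | line => cases hy
  | line t p e x hw _ ih =>
    generalize hy : (Outlet.ofLine e : Outlet N.Switch N.size N.Line) = y at h'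
    generalize hs : t + N.delay e = s at h'
    cases h' with
    | arrival => cases hy
    | switch => cases hy
    | line t' p' e' x' hw' hx' =>
      injection hy with he
      subst he
      have ht : t = t' := by omega
      subst ht
      rw [hw] at hw'
      cases hw'
      exact ih hx'

variable (N) (σ) (arr)

/-- In slot `t`, packet `p` is on the link that ends at inlet `y`. -/
def Receives (t : ℕ) (y : Inlet N.Switch N.size N.Line) (p : ℕ) : Prop :=
  ∃ x, N.wire y = some x ∧ N.At σ arr t x p

open Classical in
/-- The packet on the link that ends at inlet `y` in slot `t`, if any. -/
noncomputable def content (t : ℕ) (y : Inlet N.Switch N.size N.Line) : Option ℕ :=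
  if h : ∃ p, N.Receives σ arr t y p then some h.choose else none

theorem content_eq_some_iff (t : ℕ) (y : Inlet N.Switch N.size N.Line) (p : ℕ) :
    N.content σ arr t y = some p ↔ N.Receives σ arr t y p := by
  have huniq : ∀ p p', N.Receives σ arr t y p → N.Receives σ arr t y p' → p = p' := by
    rintro p p' ⟨x, hx, h⟩ ⟨x', hx', h'⟩
    rw [hx] at hx'
    cases hx'
    exact h.unique h'
  unfold content
  split_ifs with h
  · constructor
    · intro e
      cases e
      exact h.choose_spec
    · intro hp
      rw [huniq _ _ h.choose_spec hp]
  · constructor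
    · intro e
      cases e
    · intro hp
      exact absurd ⟨p, hp⟩ h

/-- The packets inside the delay lines at the beginning of slot `t`: they entered a delay line in
an earlier slot `s` and have not emerged before slot `t`. -/
def buffered (t : ℕ) : Set ℕ :=
  {p | ∃ (e : N.Line) (s : ℕ), s < t ∧ t ≤ s + N.delay e ∧ N.Receives σ arr s (.toLine e) p}

theorem finite_buffered (t : ℕ) : (N.buffered σ arr t).Finite := by
  refine (Set.finite_lt_nat t).subset ?_
  rintro p ⟨e, s, hs, -, x, -, hx⟩
  exact lt_of_le_of_lt hx.le hs

/-- The behaviour of the network, seen as a queueing element, under given arrivals, departure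
requests and switch settings. -/
noncomputable def trace (req : ℕ → Bool) : QueueTrace α where
  arrival := arr
  request := req
  departure := fun t => N.content σ arr t .departure
  loss := fun t => N.content σ arr t .loss
  stored := N.buffered σ arr

/-- A routing policy: in each slot `t` it sets the switches, knowing the arrivals (with their
priorities) and the departure requests of the slots `0, …, t` only. -/
abbrev Policy (α : Type u) : Type u := (t : ℕ) → (Fin (t + 1) → Option α × Bool) → N.Setting

/-- The switch settings that a policy produces on given arrivals and requests. -/
def Policy.settings {N : SDLNetwork} {α : Type u} (P : N.Policy α) (arr : ℕ → Option α)
    (req : ℕ → Bool) : ℕ → N.Setting :=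
  fun t => P t (fun s => (arr s, req s))

/-- Starting empty, the network can be operated as a priority queue with buffer `B`, whatever the
arrivals (with distinct priorities from a linearly ordered set) and departure requests are. -/
def IsPriorityQueue (B : ℕ) : Prop :=
  ∀ (α : Type u) [LinearOrder α], ∃ P : N.Policy α, ∀ (arr : ℕ → Option α) (req : ℕ → Bool),
    (∀ s t x, arr s = some x → arr t = some x → s = t) →
      (N.trace (P.settings arr req) arr req).IsPriorityQueue B

end SDLNetwork

/-! ## Binary expansions -/

namespace PriorityQueueNetwork

/-! The network imitates an ideal queue whose contents are determined by the past (`queue`); what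
must be shown is that every packet is at the main switch in the slot in which it departs or is lost.
The depth of a packet is the distance of its rank from the two ends of a full queue. It changes by
at most one per slot, a packet leaves only at depth at most 1, and at most `2 * (x - 1)` packets
have depth below `x` (`depthProcess_queue`). So a packet of large depth can safely be sent away for
a time comparable to its depth.

Let `c = 2 ^ b` be 1 or 2. A flight of class `j + 1` begins at depth at least `c * 4 ^ (j + 1)` and
lasts at most `3 * (c * 4 ^ j)` slots; a flight of class 0 lasts one slot, in one of 14 lines of
delay 1. Each positive class is a waiting line that releases up to 16 packets per slot: position `n`
comes out in slot `n / 16`. Consecutive flights of a packet differ in class by at most one, so at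
most `3 * 16 = 48` packets enter a class per slot. Packets of a class are either of bounded depth or
recent arrivals still climbing through the classes, so there are at most `48 * (c * 4 ^ j)` of them,
and 16 releases per slot give the bound on the length of a flight. These facts depend on each other
and are carried through time together by `Schedule.Valid.step`.

Position `n` is served by element `n % 48` of its class, a switch with lines of delay 1, 2, 4, … fed
back. A packet visits the lines given by the binary digits of its delay, lowest first. Two packets
of one element have positions differing by `48 * u`, hence exit slots differing by `3 * u`. If they
met at the line of delay `2 ^ s`, then `2 ^ s` would divide `3 * u` and therefore `u`; but positions
grow by at most 48 per slot, which forces `|u| < 2 ^ s`, so `u = 0`. This is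
`DepthProcess.no_conflict`.

Without collisions every switch has to realize a partial injection, which extends to a permutation.
By `expected_of_at` and `at_of_expected` the packets are then exactly where the schedule puts them,
and `network_trace` identifies the network with the ideal queue. The available parts exceed what is
needed; the rest stay idle. -/

theorem mod_two_pow_succ_of_testBit {x s : ℕ} (h : x.testBit s = true) :
    x % 2 ^ (s + 1) = x % 2 ^ s + 2 ^ s := by
  have := Nat.toNat_testBit x s
  rw [h, Bool.toNat_true] at this
  rw [Nat.mod_pow_succ, ← this, mul_one]

theorem mod_two_pow_succ_of_not_testBit {x s : ℕ} (h : x.testBit s = false) :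
    x % 2 ^ (s + 1) = x % 2 ^ s := by
  have := Nat.toNat_testBit x s
  rw [h, Bool.toNat_false] at this
  rw [Nat.mod_pow_succ, ← this, mul_zero, add_zero]

/-- The residues `x % 2 ^ s` are the partial sums of the binary expansion, low digits first. For a
flight of delay `x` they are the elapsed times at which the packet changes lines. -/
theorem mod_two_pow_mono (x : ℕ) : Monotone fun s => x % 2 ^ s :=
  monotone_nat_of_le_succ fun s => by
    cases h : x.testBit s
    · rw [mod_two_pow_succ_of_not_testBit h]
    · rw [mod_two_pow_succ_of_testBit h]; exact Nat.le_add_right _ _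

theorem mod_two_pow_lt_of_testBit {x s s' : ℕ} (h : x.testBit s = true) (hs : s < s') :
    x % 2 ^ s < x % 2 ^ s' := by
  have h1 := mod_two_pow_mono x (Nat.succ_le_of_lt hs)
  simp only [Nat.succ_eq_add_one, mod_two_pow_succ_of_testBit h] at h1
  have := Nat.two_pow_pos s
  omega

/-- The partial sums before set bits determine the bits. -/
theorem eq_of_mod_two_pow_eq {x s s' : ℕ} (h : x.testBit s = true) (h' : x.testBit s' = true)
    (e : x % 2 ^ s = x % 2 ^ s') : s = s' := by
  rcases lt_trichotomy s s' with hs | hs | hs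
  · exact absurd e (mod_two_pow_lt_of_testBit h hs).ne
  · exact hs
  · exact absurd e (mod_two_pow_lt_of_testBit h' hs).ne'

/-- The partial sums after set bits determine the bits. -/
theorem eq_of_mod_two_pow_succ_eq {x s s' : ℕ} (h : x.testBit s = true)
    (h' : x.testBit s' = true) (e : x % 2 ^ (s + 1) = x % 2 ^ (s' + 1)) : s = s' := by
  rcases lt_trichotomy s s' with hs | hs | hs
  · exact absurd e ((mod_two_pow_mono x (Nat.succ_le_of_lt hs)).trans_lt
      (mod_two_pow_lt_of_testBit h' s'.lt_succ_self)).ne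
  · exact hs
  · exact absurd e ((mod_two_pow_mono x (Nat.succ_le_of_lt hs)).trans_lt
      (mod_two_pow_lt_of_testBit h s.lt_succ_self)).ne'

/-- The partial sums climb from 0 and jump only at set bits, so some jump crosses `y`. With `y` an
elapsed time, this finds the line that holds a packet. -/
theorem exists_testBit_between {x y e : ℕ} (hy : 0 < y) (hx : y ≤ x % 2 ^ e) :
    ∃ s < e, x.testBit s = true ∧ x % 2 ^ s < y ∧ y ≤ x % 2 ^ (s + 1) := by
  induction e with
  | zero => simp only [pow_zero, Nat.mod_one] at hx; omega
  | succ e ih =>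
    by_cases h : y ≤ x % 2 ^ e
    · obtain ⟨s, hs, h'⟩ := ih h
      exact ⟨s, hs.trans e.lt_succ_self, h'⟩
    · refine ⟨e, e.lt_succ_self, ?_, by omega, hx⟩
      by_contra hb
      rw [mod_two_pow_succ_of_not_testBit (by simpa using hb)] at hx
      exact h hx

/-- The set bit preceding a partial sum. -/
theorem exists_previous_testBit {x s : ℕ} (h : 0 < x % 2 ^ s) :
    ∃ r < s, x.testBit r = true ∧ x % 2 ^ (r + 1) = x % 2 ^ s := by
  obtain ⟨r, hr, hb, -, h'⟩ := exists_testBit_between h le_rfl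
  exact ⟨r, hr, hb, le_antisymm (mod_two_pow_mono x hr) h'⟩

/-- The set bit following a partial sum. -/
theorem exists_next_testBit {x s e : ℕ} (h : x % 2 ^ s < x % 2 ^ e) :
    ∃ r < e, x.testBit r = true ∧ x % 2 ^ r = x % 2 ^ s := by
  obtain ⟨r, hr, hb, h1, h2⟩ := exists_testBit_between (Nat.succ_pos _) (Nat.succ_le_of_lt h)
  refine ⟨r, hr, hb, le_antisymm (by omega) (mod_two_pow_mono x ?_)⟩
  by_contra hs
  have := mod_two_pow_mono x (Nat.succ_le_of_lt (not_le.1 hs))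
  simp only [Nat.succ_eq_add_one] at this
  omega

/-! ## Permutations extending partial injections -/

/-- A partial injection of a finite type extends to a permutation. -/
theorem exists_perm_extending {ι τ : Type*} [Fintype ι] [DecidableEq ι] (I O : τ → ι → Prop)
    (hI : ∀ x i i', I x i → I x i' → i = i') (hI' : ∀ x x' i, I x i → I x' i → x = x')
    (hO : ∀ x i i', O x i → O x i' → i = i') (hO' : ∀ x x' i, O x i → O x' i → x = x') :
    ∃ g : Equiv.Perm ι, ∀ x i o, I x i → O x o → g i = o := by
  classical
  let R : ι → Prop := fun i => ∃ x o, I x i ∧ O x o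
  -- The value outside `R` is irrelevant: only the restriction of `f` to `R` is extended.
  let f : ι → ι := fun i => if h : R i then h.choose_spec.choose else i
  have hf : ∀ x i o, I x i → O x o → f i = o := by
    intro x i o hi ho
    have h : R i := ⟨x, o, hi, ho⟩
    have hs := h.choose_spec.choose_spec
    have hx := hI' _ _ _ hs.1 hi
    simp only [f, dif_pos h]
    exact hO _ _ _ (hx ▸ hs.2) ho
  obtain ⟨g, hg⟩ := Finset.exists_equiv_extend_of_card_eq (α := ι) (t := Finset.univ)
    (Finset.card_univ).symm (s := Finset.univ.filter R) (f := f) (Finset.subset_univ _) (by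
      intro i hi i' hi' e
      simp only [Finset.coe_filter, Finset.mem_univ, true_and, Set.mem_ofPred_eq] at hi hi'
      obtain ⟨x, o, h1, h2⟩ := hi
      obtain ⟨x', o', h1', h2'⟩ := hi'
      rw [hf _ _ _ h1 h2, hf _ _ _ h1' h2'] at e
      subst e
      have := hO' _ _ _ h2 h2'
      subst this
      exact hI _ _ _ h1 h1')
  refine ⟨g.trans (Equiv.subtypeUnivEquiv fun _ => Finset.mem_univ _), fun x i o hi ho => ?_⟩
  have := hg i (by simp only [Finset.mem_filter, Finset.mem_univ, true_and]; exact ⟨x, o, hi, ho⟩)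
  simp only [Equiv.trans_apply, Equiv.subtypeUnivEquiv_apply, this]
  exact hf _ _ _ hi ho

end PriorityQueueNetwork

/-! ## Scheduling packets by depth

The depth of a stored packet is a lower bound for the number of slots before it is needed at the
main switch. Packets of depth about `c * 4 ^ j` are sent through the delay elements of class `j`,
each of which emits at most 16 packets per slot. -/

namespace PriorityQueueNetwork

/-- A passage of a packet through the delay elements of class `cls`, beginning in slot `start`;
`pos` is its position in the queue of that class. -/
structure Flight where
  cls : ℕ
  start : ℕ
  pos : ℕ

/-- The slot in which a flight ends. -/
def Flight.out (f : Flight) : ℕ := if f.cls = 0 then f.start + 1 else f.pos / 16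

/-- The current (or last) flight of every packet, and for every class the first position that has
not been assigned yet. -/
structure Schedule where
  flight : ℕ → Flight
  count : ℕ → ℕ

/-- The class that is suitable for a packet of depth `d`. -/
def level (c d : ℕ) : ℕ := Nat.log 4 (d / c)

theorem mul_four_pow_succ (c j : ℕ) : c * 4 ^ (j + 1) = 4 * (c * 4 ^ j) := by ring

theorem le_level {c d j : ℕ} (hc : 0 < c) (h : c * 4 ^ j ≤ d) : j ≤ level c d :=
  Nat.le_log_of_pow_le (by norm_num) ((Nat.le_div_iff_mul_le hc).2 (by rwa [mul_comm]))

theorem lt_of_level {c : ℕ} (hc : 0 < c) (d : ℕ) : d < c * 4 ^ (level c d + 1) := by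
  have := Nat.lt_pow_succ_log_self (b := 4) (by norm_num) (d / c)
  rw [Nat.div_lt_iff_lt_mul hc, mul_comm] at this
  exact this

/-- The level must be positive: level 0 also covers depths below `c`, where the logarithm of 0 takes
its default value. -/
theorem le_of_le_level {c d j : ℕ} (hc : 0 < c) (h : j + 1 ≤ level c d) :
    c * 4 ^ (j + 1) ≤ d := by
  have h0 : d / c ≠ 0 := by
    intro h0
    rw [level, h0, Nat.log_zero_right] at h
    omega
  have := Nat.pow_le_of_le_log h0 h
  rw [Nat.le_div_iff_mul_le hc, mul_comm] at this
  exact this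

namespace Schedule

/-- Packet `p` is at the main switch in slot `t`. -/
def Fresh (S : Schedule) (t p : ℕ) : Prop := p = t ∨ (S.flight p).out = t

/-- The class of the flight that packet `p` begins in slot `t`. -/
def nextClass (S : Schedule) (c : ℕ) (D : ℕ → ℕ) (t p : ℕ) : ℕ :=
  min (level c (D p)) (if p = t then 1 else (S.flight p).cls + 1)

open Classical in
/-- The packets that begin a flight of class `j` in slot `t`. -/
noncomputable def entrants (S : Schedule) (c : ℕ) (Q : Finset ℕ) (D : ℕ → ℕ) (t j : ℕ) :
    Finset ℕ :=
  Q.filter fun p => S.Fresh t p ∧ S.nextClass c D t p = j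

/-- The first position assigned in slot `t`. -/
def base (S : Schedule) (t j : ℕ) : ℕ := if j = 0 then 0 else max (S.count j) (16 * (t + 1))

open Classical in
/-- The schedule after slot `t`, if `Q` is the set of packets that stay and `D` their depth. -/
noncomputable def step (S : Schedule) (c : ℕ) (Q : Finset ℕ) (D : ℕ → ℕ) (t : ℕ) : Schedule where
  flight p := if S.Fresh t p then
      ⟨S.nextClass c D t p, t, S.base t (S.nextClass c D t p) +
        ((S.entrants c Q D t (S.nextClass c D t p)).filter fun q => q < p).card⟩
    else S.flight p
  count j := S.base t j + (S.entrants c Q D t j).card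

/-- The invariants of a schedule at the beginning of slot `t`, if `Q` is the set of stored packets
and `D` their depth. -/
structure Valid (S : Schedule) (c J : ℕ) (Q : Finset ℕ) (D : ℕ → ℕ) (t : ℕ) : Prop where
  le_start : ∀ p ∈ Q, p ≤ (S.flight p).start
  start_lt : ∀ p ∈ Q, (S.flight p).start < t
  le_out : ∀ p ∈ Q, t ≤ (S.flight p).out
  cls_le : ∀ p ∈ Q, (S.flight p).cls ≤ J
  out_le : ∀ p ∈ Q, ∀ j, (S.flight p).cls = j + 1 →
    (S.flight p).out ≤ (S.flight p).start + 3 * (c * 4 ^ j)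
  depth_ge : ∀ p ∈ Q, ∀ j, (S.flight p).cls = j + 1 →
    c * 4 ^ (j + 1) + (S.flight p).start + 1 ≤ D p + t
  depth_lt : ∀ p ∈ Q, D p + (S.flight p).start + 1 < c * 4 ^ ((S.flight p).cls + 1) + t ∨
    ∃ j, (S.flight p).cls = j + 1 ∧ (S.flight p).start + c ≤ p + c * 4 ^ j
  pos_lt_of_zero : ∀ p ∈ Q, (S.flight p).cls = 0 → (S.flight p).pos < 14
  pos_inj : ∀ p ∈ Q, ∀ q ∈ Q, (S.flight p).cls = (S.flight q).cls →
    (S.flight p).pos = (S.flight q).pos → p = q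
  pos_lt : ∀ p ∈ Q, ∀ j, (S.flight p).cls = j + 1 → (S.flight p).pos < S.count (j + 1)
  base_le : ∀ p ∈ Q, ∀ j, (S.flight p).cls = j + 1 →
    S.base t (j + 1) ≤ (S.flight p).pos + 48 * (t - (S.flight p).start)
  lipschitz : ∀ p ∈ Q, ∀ q ∈ Q, ∀ j, (S.flight p).cls = j + 1 → (S.flight q).cls = j + 1 →
    (S.flight p).start ≤ (S.flight q).start →
    (S.flight q).pos < (S.flight p).pos + 48 * ((S.flight q).start + 1 - (S.flight p).start)
  pos_mono : ∀ p ∈ Q, ∀ q ∈ Q, ∀ j, (S.flight p).cls = j + 1 → (S.flight q).cls = j + 1 →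
    (S.flight p).start < (S.flight q).start → (S.flight p).pos < (S.flight q).pos
  contiguous : ∀ j n, 16 * t ≤ n → n < S.count (j + 1) →
    ∃ p ∈ Q, (S.flight p).cls = j + 1 ∧ (S.flight p).pos = n

end Schedule

/-- What happens to the stored packets and their depths in slot `t`. -/
structure DepthStep (c J t : ℕ) (Q : Finset ℕ) (D : ℕ → ℕ) (Q' : Finset ℕ) (D' : ℕ → ℕ) :
    Prop where
  lt : ∀ p ∈ Q, p < t
  mem_of_mem : ∀ p ∈ Q', p ≠ t → p ∈ Q
  le_add_one : ∀ p ∈ Q, p ∈ Q' → D p ≤ D' p + 1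
  add_one_le : ∀ p ∈ Q, p ∈ Q' → D' p ≤ D p + 1
  ended : ∀ p ∈ Q, p ∉ Q' → D p ≤ 1
  card_lt : ∀ x, (Q.filter fun p => D p < x).card ≤ 2 * (x - 1)
  card_lt' : ∀ x, (Q'.filter fun p => D' p < x).card ≤ 2 * (x - 1)
  lt_top : ∀ p ∈ Q', D' p < c * 4 ^ (J + 1)

/-! ### One slot of the schedule: how many packets leave and enter a class. -/

namespace Schedule

variable {S : Schedule} {c J t : ℕ} {Q Q' : Finset ℕ} {D D' : ℕ → ℕ}

theorem step_flight_of_fresh {p : ℕ} (h : S.Fresh t p) :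
    (S.step c Q' D' t).flight p = ⟨S.nextClass c D' t p, t, S.base t (S.nextClass c D' t p) +
        ((S.entrants c Q' D' t (S.nextClass c D' t p)).filter fun q => q < p).card⟩ := by
  simp only [step, if_pos h]

theorem step_flight_of_not_fresh {p : ℕ} (h : ¬ S.Fresh t p) :
    (S.step c Q' D' t).flight p = S.flight p := by
  simp only [step, if_neg h]

theorem mem_entrants {p j : ℕ} :
    p ∈ S.entrants c Q' D' t j ↔ p ∈ Q' ∧ S.Fresh t p ∧ S.nextClass c D' t p = j := by
  classical
  simp only [entrants, Finset.mem_filter]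

namespace Valid

/-- A packet that is inside a delay element stays in the queue. -/
theorem mem_of_lt_out (hS : S.Valid c J Q D t) (hD : DepthStep c J t Q D Q' D') {p : ℕ}
    (hp : p ∈ Q) (h : t < (S.flight p).out) : p ∈ Q' := by
  by_contra hp'
  have h1 := hD.ended p hp hp'
  have h2 := hS.start_lt p hp
  rcases hj : (S.flight p).cls with _ | j
  · simp only [Flight.out, hj, if_true] at h
    omega
  -- With `y = c * 4 ^ j`, the flight begins at depth at least `4 * y` and lasts at most `3 * y`
  -- slots, so before its end the depth is still above `y`, too large for a packet that leaves.
  · have h3 := hS.out_le p hp j hj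
    have h4 := hS.depth_ge p hp j hj
    rw [mul_four_pow_succ] at h4
    omega

theorem not_fresh (hS : S.Valid c J Q D t) (hD : DepthStep c J t Q D Q' D') {p : ℕ}
    (hp : p ∈ Q') (h : ¬ S.Fresh t p) : p ∈ Q ∧ p ≠ t ∧ t < (S.flight p).out := by
  simp only [Fresh, not_or] at h
  have hQ := hD.mem_of_mem p hp h.1
  exact ⟨hQ, h.1, lt_of_le_of_ne (hS.le_out p hQ) (Ne.symm h.2)⟩

/-- At most 16 packets emerge from each class. -/
theorem card_emerging_le (hS : S.Valid c J Q D t) (j : ℕ) :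
    (Q.filter fun p => (S.flight p).cls = j + 1 ∧ (S.flight p).out = t).card ≤ 16 := by
  have : (Q.filter fun p => (S.flight p).cls = j + 1 ∧ (S.flight p).out = t).card ≤
      (Finset.Ico (16 * t) (16 * t + 16)).card := by
    refine Finset.card_le_card_of_injOn (fun p => (S.flight p).pos) ?_ ?_
    · intro p hp
      simp only [Finset.coe_filter, Set.mem_ofPred_eq] at hp
      obtain ⟨-, h1, h2⟩ := hp
      simp only [Flight.out, h1, Nat.add_eq_zero_iff, one_ne_zero, and_false, if_false] at h2
      simp only [Finset.coe_Ico, Set.mem_Ico]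
      omega
    · intro p hp q hq e
      simp only [Finset.coe_filter, Set.mem_ofPred_eq] at hp hq
      exact hS.pos_inj p hp.1 q hq.1 (hp.2.1.trans hq.2.1.symm) e
  simpa using this

/-- The class drops by at most one between flights. With `y = c * 4 ^ (j + 1)`, at most `3 * y` of
an initial depth of at least `4 * y` is used up. -/
theorem level_ge (hS : S.Valid c J Q D t) (hD : DepthStep c J t Q D Q' D') (hc : 0 < c) {p j : ℕ}
    (hp : p ∈ Q) (hp' : p ∈ Q') (hj : (S.flight p).cls = j + 2) (h : (S.flight p).out = t) :
    j + 1 ≤ level c (D' p) := by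
  apply le_level hc
  have h1 := hS.depth_ge p hp _ hj
  have h2 := hS.out_le p hp _ hj
  have h3 := hD.le_add_one p hp hp'
  rw [mul_four_pow_succ] at h1
  omega

/-- The cap in `nextClass` is never 0, so class 0 means level 0 and depth below `4 * c ≤ 8`. Each
end of the queue contributes at most 7 such packets; this is why 14 unit lines suffice. -/
theorem card_entrants_zero_le (hD : DepthStep c J t Q D Q' D') (hc : 0 < c) (hc2 : c ≤ 2) :
    (S.entrants c Q' D' t 0).card ≤ 14 := by
  refine (Finset.card_le_card (t := Q'.filter fun p => D' p < c * 4) ?_).trans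
    ((hD.card_lt' _).trans (by omega))
  intro p hp
  rw [mem_entrants] at hp
  rw [Finset.mem_filter]
  refine ⟨hp.1, ?_⟩
  have h : level c (D' p) = 0 := by
    have := hp.2.2
    simp only [nextClass] at this
    split_ifs at this <;> omega
  have := lt_of_level hc (D' p)
  rwa [h, zero_add, pow_one] at this

theorem card_zero_le (hS : S.Valid c J Q D t) (hD : DepthStep c J t Q D Q' D') (hc2 : c ≤ 2) :
    (Q.filter fun p => (S.flight p).cls = 0 ∧ (S.flight p).out = t).card ≤ 14 := by
  refine (Finset.card_le_card (t := Q.filter fun p => D p < c * 4) ?_).trans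
    ((hD.card_lt _).trans (by omega))
  intro p hp
  rw [Finset.mem_filter] at hp ⊢
  refine ⟨hp.1, ?_⟩
  have h1 := hp.2.2
  simp only [Flight.out, hp.2.1, if_true] at h1
  rcases hS.depth_lt p hp.1 with h | ⟨j, hj, -⟩
  · rw [hp.2.1, zero_add, pow_one] at h
    omega
  · omega

/-- At most 48 packets enter each class. -/
theorem card_entrants_le (hS : S.Valid c J Q D t) (hD : DepthStep c J t Q D Q' D') (hc : 0 < c)
    (hc2 : c ≤ 2) (j : ℕ) : (S.entrants c Q' D' t (j + 1)).card ≤ 48 := by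
  classical
  let E : ℕ → Finset ℕ := fun i => Q.filter fun p => (S.flight p).cls = i ∧ (S.flight p).out = t
  -- `nextClass` lets the class rise by at most one, and `level_ge` lets it fall by at most one; an
  -- arrival enters class 1 at most.
  have key : ∀ p ∈ S.entrants c Q' D' t (j + 1), (p = t ∧ j = 0) ∨ p ∈ E j ∨ p ∈ E (j + 1) ∨
      p ∈ E (j + 2) := by
    intro p hp
    obtain ⟨hp', hf, hn⟩ := mem_entrants.1 hp
    by_cases hpt : p = t
    · simp only [nextClass, if_pos hpt] at hn
      exact Or.inl ⟨hpt, by omega⟩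
    · right
      have hQ := hD.mem_of_mem p hp' hpt
      have ho : (S.flight p).out = t := hf.resolve_left hpt
      simp only [nextClass, if_neg hpt] at hn
      simp only [E, Finset.mem_filter, hQ, ho, and_true, true_and]
      by_contra hne
      obtain ⟨i, hi⟩ : ∃ i, (S.flight p).cls = i + 2 := ⟨(S.flight p).cls - 2, by omega⟩
      have := hS.level_ge hD hc hQ hp' hi ho
      omega
  have h16 : ∀ i, (E (i + 1)).card ≤ 16 := fun i => hS.card_emerging_le i
  -- Class 1 receives at most `14 + 16 + 16` packets and the arrival; every higher class receives at
  -- most three times 16.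
  rcases j with _ | j
  · have h14 : (E 0).card ≤ 14 := hS.card_zero_le hD hc2
    calc (S.entrants c Q' D' t (0 + 1)).card ≤ (insert t (E 0 ∪ (E 1 ∪ E 2))).card := by
          refine Finset.card_le_card fun p hp => ?_
          rcases key p hp with h | h | h | h <;> simp [h]
      _ ≤ (E 0).card + ((E 1).card + (E 2).card) + 1 :=
          (Finset.card_insert_le _ _).trans (Nat.add_le_add_right ((Finset.card_union_le _ _).trans
            (Nat.add_le_add_left (Finset.card_union_le _ _) _)) _)
      _ ≤ 48 := by have := h16 0; have := h16 1; simp only [zero_add, one_add_one_eq_two] at *; omega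
  · calc (S.entrants c Q' D' t (j + 1 + 1)).card
        ≤ (E (j + 1) ∪ (E (j + 2) ∪ E (j + 3))).card := by
          refine Finset.card_le_card fun p hp => ?_
          rcases key p hp with h | h | h | h
          · omega
          all_goals simp [h]
      _ ≤ (E (j + 1)).card + ((E (j + 2)).card + (E (j + 3)).card) :=
          (Finset.card_union_le _ _).trans (Nat.add_le_add_left (Finset.card_union_le _ _) _)
      _ ≤ 48 := by exact add_le_add (h16 j) (add_le_add (h16 (j + 1)) (h16 (j + 2)))

end Valid

/-! ### Numbering the elements of a finite set by counting the smaller ones. -/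

theorem card_filter_lt_lt {E : Finset ℕ} {p q : ℕ} (hp : p ∈ E) (h : p < q) :
    (E.filter fun r => r < p).card < (E.filter fun r => r < q).card := by
  refine Finset.card_lt_card ((Finset.ssubset_iff_of_subset fun r hr => ?_).2 ⟨p, ?_, ?_⟩)
  · rw [Finset.mem_filter] at hr ⊢
    exact ⟨hr.1, hr.2.trans h⟩
  · simp [hp, h]
  · simp

theorem card_filter_lt_lt_card {E : Finset ℕ} {p : ℕ} (hp : p ∈ E) :
    (E.filter fun r => r < p).card < E.card :=
  Finset.card_lt_card ((Finset.ssubset_iff_of_subset (Finset.filter_subset _ _)).2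
    ⟨p, hp, by simp⟩)

theorem card_filter_lt_inj {E : Finset ℕ} {p q : ℕ} (hp : p ∈ E) (hq : q ∈ E)
    (h : (E.filter fun r => r < p).card = (E.filter fun r => r < q).card) : p = q := by
  rcases lt_trichotomy p q with h' | h' | h'
  · exact absurd h (card_filter_lt_lt hp h').ne
  · exact h'
  · exact absurd h (card_filter_lt_lt hq h').ne'

theorem exists_card_filter_lt_eq {E : Finset ℕ} {i : ℕ} (hi : i < E.card) :
    ∃ p ∈ E, (E.filter fun r => r < p).card = i := by
  have h : E.image (fun p => (E.filter fun r => r < p).card) = Finset.range E.card := by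
    refine Finset.eq_of_subset_of_card_le ?_ ?_
    · intro n hn
      obtain ⟨p, hp, rfl⟩ := Finset.mem_image.1 hn
      exact Finset.mem_range.2 (card_filter_lt_lt_card hp)
    · rw [Finset.card_range, Finset.card_image_of_injOn]
      exact fun p hp q hq e => card_filter_lt_inj hp hq e
  have := Finset.mem_range.2 hi
  rw [← h] at this
  simpa using this

/-! ### Preservation of the invariants of a schedule. -/

namespace Valid

/-- A packet that begins a flight in slot `t`. -/
theorem fresh_spec {p : ℕ} (hp : p ∈ Q') (h : S.Fresh t p) :
    ∃ j i, p ∈ S.entrants c Q' D' t j ∧ S.nextClass c D' t p = j ∧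
      i = ((S.entrants c Q' D' t j).filter fun q => q < p).card ∧
      i < (S.entrants c Q' D' t j).card ∧
      (S.step c Q' D' t).flight p = ⟨j, t, S.base t j + i⟩ := by
  have hm : p ∈ S.entrants c Q' D' t (S.nextClass c D' t p) := mem_entrants.2 ⟨hp, h, rfl⟩
  exact ⟨_, _, hm, rfl, rfl, card_filter_lt_lt_card hm, step_flight_of_fresh h⟩

/-- Either the class matched the depth when the flight began, or the packet has been climbing one
class at a time ever since it arrived. In the second case its age at the start is at most `c * (4 ^
j - 1)`, the sum of the maximal lengths `3 * (c * 4 ^ i)` of the flights of classes `i + 1 ≤ j`. -/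
theorem step_depth_lt (hS : S.Valid c J Q D t) (hD : DepthStep c J t Q D Q' D') (hc : 0 < c)
    {p : ℕ} (hp : p ∈ Q') :
    D' p + ((S.step c Q' D' t).flight p).start + 1 <
        c * 4 ^ (((S.step c Q' D' t).flight p).cls + 1) + (t + 1) ∨
      ∃ j, ((S.step c Q' D' t).flight p).cls = j + 1 ∧
        ((S.step c Q' D' t).flight p).start + c ≤ p + c * 4 ^ j := by
  by_cases hf : S.Fresh t p
  · rw [step_flight_of_fresh hf]
    dsimp only
    have hl := lt_of_level hc (D' p)
    by_cases hn : S.nextClass c D' t p = level c (D' p)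
    · left
      rw [hn]
      omega
    right
    by_cases hpt : p = t
    · refine ⟨0, ?_, by rw [hpt, pow_zero, mul_one]⟩
      simp only [nextClass, if_pos hpt] at hn ⊢
      omega
    have hQ := hD.mem_of_mem p hp hpt
    have ho : (S.flight p).out = t := hf.resolve_left hpt
    simp only [nextClass, if_neg hpt] at hn ⊢
    have hlev : (S.flight p).cls + 1 + 1 ≤ level c (D' p) := by omega
    refine ⟨(S.flight p).cls, by omega, ?_⟩
    have h1 := le_of_le_level hc hlev
    have h2 := hD.add_one_le p hQ hp
    rw [mul_four_pow_succ, mul_four_pow_succ] at h1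
    -- A class that matched the depth at the start of the last flight cannot be two levels too low
    -- at its end, since the depth grew by at most one per slot. So the packet was already climbing,
    -- and one more flight multiplies `c * 4 ^ i` by 4.
    rcases hS.depth_lt p hQ with h | ⟨i, hi, h⟩
    · exfalso
      rw [mul_four_pow_succ] at h
      rcases hj : (S.flight p).cls with _ | j
      · rw [hj] at h h1
        simp only [Flight.out, hj, if_true] at ho
        omega
      · have h3 := hS.out_le p hQ j hj
        rw [hj, mul_four_pow_succ] at h h1
        omega
    · have h3 := hS.out_le p hQ i hi
      rw [hi, mul_four_pow_succ]
      omega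
  · rw [step_flight_of_not_fresh hf]
    obtain ⟨hQ, -, -⟩ := hS.not_fresh hD hp hf
    have h2 := hD.add_one_le p hQ hp
    refine (hS.depth_lt p hQ).imp (fun h => by omega) id

/-- Put `y = c * 4 ^ j`. A packet whose class matched its depth began below `16 * y` and gained less
than `3 * y` since, so its depth is below `19 * y`; a climbing packet arrived within the last `4 *
y` slots. Together these are at most about `42 * y` packets. -/
theorem card_class_le (hS : S.Valid c J Q D t) (hD : DepthStep c J t Q D Q' D') (hc : 0 < c)
    (j : ℕ) : (Q'.filter fun p => ((S.step c Q' D' t).flight p).cls = j + 1).card ≤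
      48 * (c * 4 ^ j) := by
  have hy : 0 < c * 4 ^ j := by positivity
  have key : (Q'.filter fun p => ((S.step c Q' D' t).flight p).cls = j + 1) ⊆
      (Q'.filter fun p => D' p < 19 * (c * 4 ^ j)) ∪
        Finset.Ico (t + 1 + c - 4 * (c * 4 ^ j)) (t + 1) := by
    intro p hp
    obtain ⟨hp, hj⟩ := Finset.mem_filter.1 hp
    rw [Finset.mem_union, Finset.mem_filter, Finset.mem_Ico]
    have hpt : p < t + 1 := by
      by_cases hpt : p = t
      · omega
      · exact (hD.lt p (hD.mem_of_mem p hp hpt)).trans t.lt_succ_self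
    have hstart : t + 1 ≤ ((S.step c Q' D' t).flight p).start + 3 * (c * 4 ^ j) := by
      by_cases hf : S.Fresh t p
      · rw [step_flight_of_fresh hf]
        dsimp only
        omega
      · rw [step_flight_of_not_fresh hf] at hj ⊢
        obtain ⟨hQ, -, h⟩ := hS.not_fresh hD hp hf
        have := hS.out_le p hQ j hj
        omega
    rcases hS.step_depth_lt hD hc hp with h | ⟨i, hi, h⟩
    · left
      rw [hj, mul_four_pow_succ, mul_four_pow_succ] at h
      exact ⟨hp, by omega⟩
    · right
      obtain rfl : i = j := by omega
      omega
  have h1 := (Finset.card_le_card key).trans (Finset.card_union_le _ _)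
  have h2 := hD.card_lt' (19 * (c * 4 ^ j))
  rw [Nat.card_Ico] at h1
  omega

/-- A gap between assigned positions arises only when `base` jumps to `16 * (t + 1)`, and positions
below this value are no longer waiting. -/
theorem step_contiguous (hS : S.Valid c J Q D t) (hD : DepthStep c J t Q D Q' D') {j n : ℕ}
    (hn : 16 * (t + 1) ≤ n) (hn' : n < (S.step c Q' D' t).count (j + 1)) :
    ∃ p ∈ Q', ((S.step c Q' D' t).flight p).cls = j + 1 ∧
      ((S.step c Q' D' t).flight p).pos = n := by
  by_cases hb : S.base t (j + 1) ≤ n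
  · obtain ⟨p, hp, hi⟩ := exists_card_filter_lt_eq (E := S.entrants c Q' D' t (j + 1))
      (i := n - S.base t (j + 1)) (by simp only [step] at hn'; omega)
    obtain ⟨hp', hf, hc⟩ := mem_entrants.1 hp
    refine ⟨p, hp', ?_⟩
    rw [step_flight_of_fresh hf, hc]
    exact ⟨rfl, by dsimp only; omega⟩
  · have hn2 : n < S.count (j + 1) := by
      simp only [base, Nat.add_eq_zero_iff, one_ne_zero, and_false, if_false] at hb
      omega
    obtain ⟨p, hp, hj, hpos⟩ := hS.contiguous j n (by omega) hn2
    have ho : t < (S.flight p).out := by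
      simp only [Flight.out, hj, Nat.add_eq_zero_iff, one_ne_zero, and_false, if_false]
      omega
    refine ⟨p, hS.mem_of_lt_out hD hp ho, ?_⟩
    rw [step_flight_of_not_fresh]
    · exact ⟨hj, hpos⟩
    · have := hD.lt p hp
      simp only [Fresh]
      omega

/-- All positions from `16 * (t + 1)` up to the new one are occupied by packets of the class. There
are at most `48 * (c * 4 ^ j)` of these, and 16 are released per slot. -/
theorem step_out_le (hS : S.Valid c J Q D t) (hD : DepthStep c J t Q D Q' D') (hc : 0 < c)
    {p j : ℕ} (hp : p ∈ Q') (hj : ((S.step c Q' D' t).flight p).cls = j + 1) :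
    ((S.step c Q' D' t).flight p).out ≤
      ((S.step c Q' D' t).flight p).start + 3 * (c * 4 ^ j) := by
  by_cases hf : S.Fresh t p
  · obtain ⟨j', i, -, -, -, hi, he⟩ := fresh_spec (c := c) (D' := D') hp hf
    rw [he] at hj ⊢
    dsimp only at hj
    subst hj
    simp only [Flight.out, Nat.add_eq_zero_iff, one_ne_zero, and_false, if_false]
    have hsub : Finset.Ico (16 * (t + 1)) (S.base t (j + 1) + i + 1) ⊆
        (Q'.filter fun p => ((S.step c Q' D' t).flight p).cls = j + 1).image
          fun p => ((S.step c Q' D' t).flight p).pos := by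
      intro n hn
      rw [Finset.mem_Ico] at hn
      obtain ⟨q, hq, h1, h2⟩ := hS.step_contiguous hD (j := j) hn.1 (by simp only [step]; omega)
      exact Finset.mem_image.2 ⟨q, Finset.mem_filter.2 ⟨hq, h1⟩, h2⟩
    have h1 := (Finset.card_le_card hsub).trans Finset.card_image_le
    have h2 := hS.card_class_le hD hc j
    rw [Nat.card_Ico] at h1
    omega
  · rw [step_flight_of_not_fresh hf] at hj ⊢
    exact hS.out_le p (hS.not_fresh hD hp hf).1 j hj

theorem lt_out_of_fresh {p : ℕ} (hp : p ∈ Q') (h : S.Fresh t p) :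
    t < ((S.step c Q' D' t).flight p).out := by
  obtain ⟨j, i, -, -, -, hi, he⟩ := fresh_spec (c := c) (D' := D') hp h
  rw [he]
  simp only [Flight.out, base]
  split_ifs <;> omega

/-- The front of a class advances by the number of entrants, at most 48, or is pushed to the release
bound, which moves by 16. This is the source of the Lipschitz invariant. -/
theorem base_add_one_le (hS : S.Valid c J Q D t) (hD : DepthStep c J t Q D Q' D') (hc : 0 < c)
    (hc2 : c ≤ 2) (j : ℕ) :
    (S.step c Q' D' t).base (t + 1) (j + 1) ≤ S.base t (j + 1) + 48 := by
  have := hS.card_entrants_le hD hc hc2 j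
  simp only [base, step, Nat.add_eq_zero_iff, one_ne_zero, and_false, if_false]
  omega

theorem count_le_base (S : Schedule) (t j : ℕ) : S.count (j + 1) ≤ S.base t (j + 1) := by
  simp only [base, Nat.add_eq_zero_iff, one_ne_zero, and_false, if_false]
  omega

theorem step (hS : S.Valid c J Q D t) (hD : DepthStep c J t Q D Q' D') (hc : 0 < c)
    (hc2 : c ≤ 2) : (S.step c Q' D' t).Valid c J Q' D' (t + 1) where
  le_start p hp := by
    by_cases hf : S.Fresh t p
    · rw [step_flight_of_fresh hf]
      dsimp only
      by_cases hpt : p = t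
      · exact hpt.le
      · exact (hD.lt p (hD.mem_of_mem p hp hpt)).le
    · rw [step_flight_of_not_fresh hf]
      exact hS.le_start p (hS.not_fresh hD hp hf).1
  start_lt p hp := by
    by_cases hf : S.Fresh t p
    · rw [step_flight_of_fresh hf]
      exact t.lt_succ_self
    · rw [step_flight_of_not_fresh hf]
      exact (hS.start_lt p (hS.not_fresh hD hp hf).1).trans t.lt_succ_self
  le_out p hp := by
    by_cases hf : S.Fresh t p
    · exact lt_out_of_fresh hp hf
    · rw [step_flight_of_not_fresh hf]
      exact (hS.not_fresh hD hp hf).2.2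
  cls_le p hp := by
    by_cases hf : S.Fresh t p
    · rw [step_flight_of_fresh hf]
      refine (min_le_left _ _).trans ?_
      by_contra h
      have h1 := le_of_le_level hc (Nat.succ_le_of_lt (not_le.1 h))
      exact absurd (hD.lt_top p hp) (not_lt.2 h1)
    · rw [step_flight_of_not_fresh hf]
      exact hS.cls_le p (hS.not_fresh hD hp hf).1
  out_le p hp j hj := hS.step_out_le hD hc hp hj
  depth_ge p hp j hj := by
    by_cases hf : S.Fresh t p
    · rw [step_flight_of_fresh hf] at hj ⊢
      dsimp only at hj ⊢
      have := le_of_le_level hc (hj ▸ min_le_left _ _ : j + 1 ≤ level c (D' p))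
      omega
    · rw [step_flight_of_not_fresh hf] at hj ⊢
      obtain ⟨hQ, -, -⟩ := hS.not_fresh hD hp hf
      have h1 := hS.depth_ge p hQ j hj
      have h2 := hD.le_add_one p hQ hp
      omega
  depth_lt p hp := hS.step_depth_lt hD hc hp
  pos_lt_of_zero p hp h0 := by
    by_cases hf : S.Fresh t p
    · obtain ⟨j, i, -, -, -, hi, he⟩ := fresh_spec (c := c) (D' := D') hp hf
      rw [he] at h0 ⊢
      dsimp only at h0 ⊢
      subst h0
      have := card_entrants_zero_le (S := S) hD hc hc2
      simp only [base, if_true]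
      omega
    · rw [step_flight_of_not_fresh hf] at h0 ⊢
      exact hS.pos_lt_of_zero p (hS.not_fresh hD hp hf).1 h0
  pos_inj := by
    -- In a positive class old positions lie below `count` and new ones do not; in class 0 no flight
    -- survives the slot, so its positions can be reused.
    have aux : ∀ p ∈ Q', ∀ q ∈ Q', ¬ S.Fresh t p → S.Fresh t q →
        ((S.step c Q' D' t).flight p).cls = ((S.step c Q' D' t).flight q).cls →
        ((S.step c Q' D' t).flight p).pos = ((S.step c Q' D' t).flight q).pos → False := by
      intro p hp q hq hf hf' hcls hpos
      obtain ⟨j, i, -, -, -, hi, he⟩ := fresh_spec (c := c) (D' := D') hq hf'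
      rw [he, step_flight_of_not_fresh hf] at hcls hpos
      dsimp only at hcls hpos
      obtain ⟨hQ, -, ho⟩ := hS.not_fresh hD hp hf
      rcases j with _ | j
      · have := hS.start_lt p hQ
        simp only [Flight.out, hcls, if_true] at ho
        omega
      · have h1 := hS.pos_lt p hQ j hcls
        have h2 := count_le_base S t j
        omega
    intro p hp q hq hcls hpos
    by_cases hf : S.Fresh t p <;> by_cases hf' : S.Fresh t q
    · obtain ⟨j, i, hm, -, hi, -, he⟩ := fresh_spec (c := c) (D' := D') hp hf
      obtain ⟨j', i', hm', -, hi', -, he'⟩ := fresh_spec (c := c) (D' := D') hq hf'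
      rw [he, he'] at hcls hpos
      dsimp only at hcls hpos
      subst hcls
      exact card_filter_lt_inj hm hm' (by omega)
    · exact (aux q hq p hp hf' hf hcls.symm hpos.symm).elim
    · exact (aux p hp q hq hf hf' hcls hpos).elim
    · rw [step_flight_of_not_fresh hf, step_flight_of_not_fresh hf'] at hcls hpos
      exact hS.pos_inj p (hS.not_fresh hD hp hf).1 q (hS.not_fresh hD hq hf').1 hcls hpos
  pos_lt p hp j hj := by
    by_cases hf : S.Fresh t p
    · obtain ⟨j', i, -, -, -, hi, he⟩ := fresh_spec (c := c) (D' := D') hp hf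
      rw [he] at hj ⊢
      dsimp only at hj
      subst hj
      simp only [Schedule.step]
      omega
    · rw [step_flight_of_not_fresh hf] at hj ⊢
      have h1 := hS.pos_lt p (hS.not_fresh hD hp hf).1 j hj
      have h2 := count_le_base S t j
      simp only [Schedule.step]
      omega
  base_le p hp j hj := by
    have hb := hS.base_add_one_le hD hc hc2 j
    by_cases hf : S.Fresh t p
    · obtain ⟨j', i, -, -, -, hi, he⟩ := fresh_spec (c := c) (D' := D') hp hf
      rw [he] at hj ⊢
      dsimp only at hj ⊢
      subst hj
      omega
    · rw [step_flight_of_not_fresh hf] at hj ⊢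
      obtain ⟨hQ, -, -⟩ := hS.not_fresh hD hp hf
      have h1 := hS.base_le p hQ j hj
      have h2 := hS.start_lt p hQ
      omega
  lipschitz p hp q hq j hj hj' hle := by
    have he := hS.card_entrants_le hD hc hc2 j
    by_cases hf : S.Fresh t p <;> by_cases hf' : S.Fresh t q
    · obtain ⟨k, i, -, -, -, hi, h⟩ := fresh_spec (c := c) (D' := D') hp hf
      obtain ⟨k', i', -, -, -, hi', h'⟩ := fresh_spec (c := c) (D' := D') hq hf'
      rw [h] at hj ⊢
      rw [h'] at hj' ⊢
      dsimp only at hj hj' ⊢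
      subst hj hj'
      omega
    · rw [step_flight_of_fresh hf, step_flight_of_not_fresh hf'] at hle
      have := hS.start_lt q (hS.not_fresh hD hq hf').1
      dsimp only at hle
      omega
    · obtain ⟨k', i', -, -, -, hi', h'⟩ := fresh_spec (c := c) (D' := D') hq hf'
      rw [step_flight_of_not_fresh hf] at hj ⊢
      rw [h'] at hj' ⊢
      dsimp only at hj' ⊢
      subst hj'
      -- The new position exceeds `base` by less than 48, and `base_le` compares `base` with the
      -- older position at 48 per elapsed slot.
      have hQ := (hS.not_fresh hD hp hf).1
      have h1 := hS.base_le p hQ j hj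
      have h2 := hS.start_lt p hQ
      omega
    · rw [step_flight_of_not_fresh hf] at hj hle ⊢
      rw [step_flight_of_not_fresh hf'] at hj' hle ⊢
      exact hS.lipschitz p (hS.not_fresh hD hp hf).1 q (hS.not_fresh hD hq hf').1 j hj hj' hle
  pos_mono p hp q hq j hj hj' hlt := by
    by_cases hf : S.Fresh t p <;> by_cases hf' : S.Fresh t q
    · rw [step_flight_of_fresh hf, step_flight_of_fresh hf'] at hlt
      exact absurd hlt (lt_irrefl t)
    · rw [step_flight_of_fresh hf, step_flight_of_not_fresh hf'] at hlt
      have := hS.start_lt q (hS.not_fresh hD hq hf').1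
      dsimp only at hlt
      omega
    · obtain ⟨k', i', -, -, -, hi', h'⟩ := fresh_spec (c := c) (D' := D') hq hf'
      rw [step_flight_of_not_fresh hf] at hj ⊢
      rw [h'] at hj' ⊢
      dsimp only at hj' ⊢
      subst hj'
      have h1 := hS.pos_lt p (hS.not_fresh hD hp hf).1 j hj
      have h2 := count_le_base S t j
      omega
    · rw [step_flight_of_not_fresh hf] at hj hlt ⊢
      rw [step_flight_of_not_fresh hf'] at hj' hlt ⊢
      exact hS.pos_mono p (hS.not_fresh hD hp hf).1 q (hS.not_fresh hD hq hf').1 j hj hj' hlt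
  contiguous j n hn hn' := hS.step_contiguous hD hn hn'

end Valid

end Schedule

/-- The schedule at the beginning of every slot. -/
noncomputable def schedule (c : ℕ) (Q : ℕ → Finset ℕ) (D : ℕ → ℕ → ℕ) : ℕ → Schedule
  | 0 => ⟨fun _ => ⟨0, 0, 0⟩, fun _ => 0⟩
  | t + 1 => (schedule c Q D t).step c (Q (t + 1)) (D (t + 1)) t

theorem schedule_congr {c : ℕ} {Q Q' : ℕ → Finset ℕ} {D D' : ℕ → ℕ → ℕ} {t : ℕ}
    (hQ : ∀ s ≤ t, Q s = Q' s) (hD : ∀ s ≤ t, D s = D' s) :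
    schedule c Q D t = schedule c Q' D' t := by
  induction t with
  | zero => rfl
  | succ t ih =>
    rw [schedule, schedule, ih (fun s hs => hQ s (by omega)) (fun s hs => hD s (by omega)),
      hQ _ le_rfl, hD _ le_rfl]

/-- The stored packets and their depths in all slots, starting from an empty queue. -/
structure DepthProcess (c J : ℕ) (Q : ℕ → Finset ℕ) (D : ℕ → ℕ → ℕ) : Prop where
  pos : 0 < c
  le_two : c ≤ 2
  zero : Q 0 = ∅
  step : ∀ t, DepthStep c J t (Q t) (D t) (Q (t + 1)) (D (t + 1))

/-! ### Flights followed through time, and the absence of collisions. -/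

namespace DepthProcess

variable {c J : ℕ} {Q : ℕ → Finset ℕ} {D : ℕ → ℕ → ℕ}

theorem valid (H : DepthProcess c J Q D) (t : ℕ) :
    (schedule c Q D t).Valid c J (Q t) (D t) t := by
  induction t with
  | zero =>
    rw [H.zero]
    constructor <;> simp [schedule]
  | succ t ih => exact ih.step (H.step t) H.pos H.le_two

theorem succ_of_lt_out (H : DepthProcess c J Q D) {t p : ℕ} (hp : p ∈ Q t)
    (h : t < ((schedule c Q D t).flight p).out) :
    p ∈ Q (t + 1) ∧ (schedule c Q D (t + 1)).flight p = (schedule c Q D t).flight p := by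
  refine ⟨(H.valid t).mem_of_lt_out (H.step t) hp h, Schedule.step_flight_of_not_fresh ?_⟩
  have := (H.step t).lt p hp
  simp only [Schedule.Fresh]
  omega

/-- A flight continues until it ends. -/
theorem forward (H : DepthProcess c J Q D) {s t p : ℕ} (hp : p ∈ Q s) (hst : s ≤ t)
    (h : t ≤ ((schedule c Q D s).flight p).out) :
    p ∈ Q t ∧ (schedule c Q D t).flight p = (schedule c Q D s).flight p := by
  induction t, hst using Nat.le_induction with
  | base => exact ⟨hp, rfl⟩
  | succ t hst ih =>
    obtain ⟨h1, h2⟩ := ih (by omega)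
    obtain ⟨h3, h4⟩ := H.succ_of_lt_out h1 (by rw [h2]; omega)
    exact ⟨h3, h4.trans h2⟩

theorem pred_of_start_lt (H : DepthProcess c J Q D) {t p : ℕ} (hp : p ∈ Q (t + 1))
    (h : ((schedule c Q D (t + 1)).flight p).start < t) :
    p ∈ Q t ∧ (schedule c Q D t).flight p = (schedule c Q D (t + 1)).flight p ∧
      t < ((schedule c Q D (t + 1)).flight p).out := by
  by_cases hf : (schedule c Q D t).Fresh t p
  · rw [schedule, Schedule.step_flight_of_fresh hf] at h
    exact absurd h (lt_irrefl t)
  · obtain ⟨h1, -, h2⟩ := (H.valid t).not_fresh (H.step t) hp hf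
    rw [schedule, Schedule.step_flight_of_not_fresh hf]
    exact ⟨h1, rfl, h2⟩

/-- A flight has been going on since it began. -/
theorem backward (H : DepthProcess c J Q D) {s t p : ℕ} (hp : p ∈ Q t) (hst : s ≤ t)
    (h : ((schedule c Q D t).flight p).start < s) :
    p ∈ Q s ∧ (schedule c Q D s).flight p = (schedule c Q D t).flight p := by
  induction t, hst using Nat.le_induction with
  | base => exact ⟨hp, rfl⟩
  | succ t hst ih =>
    obtain ⟨h1, h2, -⟩ := H.pred_of_start_lt hp (by omega)
    obtain ⟨h3, h4⟩ := ih h1 (by rw [h2]; exact h)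
    exact ⟨h3, h4.trans h2⟩

theorem start_eq_iff (H : DepthProcess c J Q D) {t p : ℕ} (hp : p ∈ Q (t + 1)) :
    ((schedule c Q D (t + 1)).flight p).start = t ↔
      p = t ∨ p ∈ Q t ∧ ((schedule c Q D t).flight p).out = t := by
  by_cases hf : (schedule c Q D t).Fresh t p
  · rw [schedule, Schedule.step_flight_of_fresh hf]
    simp only [true_iff]
    by_cases hpt : p = t
    · exact Or.inl hpt
    · exact Or.inr ⟨(H.step t).mem_of_mem p hp hpt, hf.resolve_left hpt⟩
  · obtain ⟨h1, h3, h2⟩ := (H.valid t).not_fresh (H.step t) hp hf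
    rw [schedule, Schedule.step_flight_of_not_fresh hf]
    have := (H.valid t).start_lt p h1
    constructor
    · omega
    · rintro (h | ⟨-, h⟩) <;> omega

theorem out_of_ended (H : DepthProcess c J Q D) {t p : ℕ} (hp : p ∈ Q t) (hp' : p ∉ Q (t + 1)) :
    ((schedule c Q D t).flight p).out = t := by
  by_contra h
  exact hp' (H.succ_of_lt_out hp
    (lt_of_le_of_ne ((H.valid t).le_out p hp) (Ne.symm h))).1

theorem start_lt_out (H : DepthProcess c J Q D) {t p : ℕ} (hp : p ∈ Q t) :
    ((schedule c Q D t).flight p).start < ((schedule c Q D t).flight p).out :=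
  ((H.valid t).start_lt p hp).trans_le ((H.valid t).le_out p hp)

/-- A length of at most `3 * (c * 4 ^ j)` is below the number of delays that an element of class `j
+ 1` can produce, `c * 4 ^ (j + 1) = 2 ^ (2 * (j + 1) + b)` for `c = 2 ^ b`. -/
theorem delay_lt (H : DepthProcess c J Q D) {t p j : ℕ} (hp : p ∈ Q t)
    (hj : ((schedule c Q D t).flight p).cls = j + 1) :
    ((schedule c Q D t).flight p).out - ((schedule c Q D t).flight p).start < c * 4 ^ (j + 1) := by
  have h := (H.valid t).out_le p hp j hj
  have hy : 0 < c * 4 ^ j := Nat.mul_pos H.pos (by positivity)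
  rw [mul_four_pow_succ]
  omega

/-- Two packets in the same delay element never collide. -/
theorem no_conflict (H : DepthProcess c J Q D) {t p q j s : ℕ} (hp : p ∈ Q t) (hq : q ∈ Q t)
    (hj : ((schedule c Q D t).flight p).cls = j + 1)
    (hj' : ((schedule c Q D t).flight q).cls = j + 1)
    (hmod : ((schedule c Q D t).flight p).pos % 48 = ((schedule c Q D t).flight q).pos % 48)
    (htime : ((schedule c Q D t).flight p).start + (((schedule c Q D t).flight p).out -
        ((schedule c Q D t).flight p).start) % 2 ^ s =
      ((schedule c Q D t).flight q).start + (((schedule c Q D t).flight q).out -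
        ((schedule c Q D t).flight q).start) % 2 ^ s) : p = q := by
  have hV := H.valid t
  have hinj := hV.pos_inj p hp q hq (hj.trans hj'.symm)
  have hlip := hV.lipschitz p hp q hq j hj hj'
  have hlip' := hV.lipschitz q hq p hp j hj' hj
  have hmono := hV.pos_mono p hp q hq j hj hj'
  have hmono' := hV.pos_mono q hq p hp j hj' hj
  have hs := H.start_lt_out hp
  have hs' := H.start_lt_out hq
  generalize hf : (schedule c Q D t).flight p = f at *
  generalize hg : (schedule c Q D t).flight q = g at *
  have ho : f.out = f.pos / 16 := by simp [Flight.out, hj]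
  have ho' : g.out = g.pos / 16 := by simp [Flight.out, hj']
  have hm := Nat.mod_lt (f.out - f.start) (Nat.two_pow_pos s)
  have hm' := Nat.mod_lt (g.out - g.start) (Nat.two_pow_pos s)
  have hdiv := Nat.mod_add_div (f.out - f.start) (2 ^ s)
  have hdiv' := Nat.mod_add_div (g.out - g.start) (2 ^ s)
  generalize (f.out - f.start) % 2 ^ s = x at *
  generalize (g.out - g.start) % 2 ^ s = y at *
  generalize (f.out - f.start) / 2 ^ s = k at *
  generalize (g.out - g.start) / 2 ^ s = l at *
  obtain ⟨u, hu⟩ : ∃ u : ℤ, (g.pos : ℤ) - f.pos = 48 * u :=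
    ⟨(g.pos : ℤ) / 48 - f.pos / 48, by omega⟩
  -- The exit slot is the position divided by 16, so the exits differ by exactly `3 * u`. From the
  -- common meeting slot on, both remaining times are multiples of `2 ^ s`.
  have h3 : (2 : ℤ) ^ s * ((l : ℤ) - k) = 3 * u := by
    have e1 : (g.out : ℤ) - f.out = 3 * u := by omega
    have e2 : (x : ℤ) + 2 ^ s * k = f.out - f.start := by
      have : ((x + 2 ^ s * k : ℕ) : ℤ) = ((f.out - f.start : ℕ) : ℤ) := by rw [hdiv]
      push_cast [Nat.cast_sub hs.le] at this
      exact this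
    have e3 : (y : ℤ) + 2 ^ s * l = g.out - g.start := by
      have : ((y + 2 ^ s * l : ℕ) : ℤ) = ((g.out - g.start : ℕ) : ℤ) := by rw [hdiv']
      push_cast [Nat.cast_sub hs'.le] at this
      exact this
    have e4 : (f.start : ℤ) + x = g.start + y := by exact_mod_cast htime
    linear_combination e1 + e3 - e2 + e4
  have hdvd : (2 : ℤ) ^ s ∣ u := by
    have h23 : IsCoprime ((2 : ℤ) ^ s) 3 := IsCoprime.pow_left ⟨-1, 1, by norm_num⟩
    exact h23.dvd_of_dvd_mul_left ⟨_, h3.symm⟩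
  -- The starts differ by less than `2 ^ s`, because both elapsed times are residues. The Lipschitz
  -- bound of 48 positions per slot, and monotonicity for the sign, transfer this to `u`.
  have habs : |u| < 2 ^ s := by
    rw [abs_lt]
    zify at *
    rcases lt_trichotomy f.start g.start with h | h | h
    all_goals constructor <;> omega
  have hu0 := Int.eq_zero_of_abs_lt_dvd hdvd habs
  exact hinj (by omega)

end DepthProcess

end PriorityQueueNetwork

/-! ## The ideal priority queue -/

namespace PriorityQueueNetwork

/-! ### Ranks by priority in a finite set of packets. -/

section Rank

variable {α : Type*} [LinearOrder α]

open Classical in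
/-- The rank of packet `i` by priority among the packets in `P`. -/
noncomputable def rankIn (arr : ℕ → Option α) (P : Finset ℕ) (i : ℕ) : ℕ :=
  (P.filter fun k => ∃ x y, arr k = some x ∧ arr i = some y ∧ y ≤ x).card

theorem rankIn_congr {arr arr' : ℕ → Option α} {P : Finset ℕ} (h : ∀ p ∈ P, arr p = arr' p)
    {i : ℕ} (hi : i ∈ P) : rankIn arr P i = rankIn arr' P i := by
  classical
  simp only [rankIn]
  congr 1
  refine Finset.filter_congr fun k hk => ?_
  rw [h k hk, h i hi]

theorem rankIn_mono (arr : ℕ → Option α) {S P : Finset ℕ} (h : S ⊆ P) (i : ℕ) :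
    rankIn arr S i ≤ rankIn arr P i := by
  classical
  exact Finset.card_le_card (Finset.filter_subset_filter _ h)

theorem rankIn_le_add (arr : ℕ → Option α) (S P : Finset ℕ) (i : ℕ) :
    rankIn arr P i ≤ rankIn arr S i + (P \ S).card := by
  classical
  refine (Finset.card_le_card fun k hk => ?_).trans (Finset.card_union_le _ _)
  rw [Finset.mem_filter] at hk
  by_cases hS : k ∈ S
  · exact Finset.mem_union_left _ (Finset.mem_filter.2 ⟨hS, hk.2⟩)
  · exact Finset.mem_union_right _ (Finset.mem_sdiff.2 ⟨hk.1, hS⟩)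

theorem rankIn_le_card (arr : ℕ → Option α) (P : Finset ℕ) (i : ℕ) : rankIn arr P i ≤ P.card := by
  classical
  exact Finset.card_le_card (Finset.filter_subset _ _)

variable {arr : ℕ → Option α}

theorem rankIn_pos {P : Finset ℕ} {i : ℕ} (hi : i ∈ P) (h : (arr i).isSome) :
    0 < rankIn arr P i := by
  classical
  obtain ⟨x, hx⟩ := Option.isSome_iff_exists.1 h
  exact Finset.card_pos.2 ⟨i, Finset.mem_filter.2 ⟨hi, x, x, hx, hx, le_rfl⟩⟩

theorem rankIn_lt {P : Finset ℕ} {p q : ℕ} {x y : α} (hp : p ∈ P) (hx : arr p = some x)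
    (hy : arr q = some y) (h : x < y) : rankIn arr P q < rankIn arr P p := by
  classical
  refine Finset.card_lt_card ((Finset.ssubset_iff_of_subset fun k hk => ?_).2 ⟨p, ?_, ?_⟩)
  · rw [Finset.mem_filter] at hk ⊢
    obtain ⟨hk, z, w, hz, hw, hle⟩ := hk
    rw [hy] at hw
    cases hw
    exact ⟨hk, z, x, hz, hx, h.le.trans hle⟩
  · exact Finset.mem_filter.2 ⟨hp, x, x, hx, hx, le_rfl⟩
  · rw [Finset.mem_filter]
    rintro ⟨-, z, w, hz, hw, hle⟩
    rw [hx] at hz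
    rw [hy] at hw
    cases hz
    cases hw
    exact absurd h (not_lt.2 hle)

theorem rankIn_injOn (hdist : ∀ s t x, arr s = some x → arr t = some x → s = t) {P : Finset ℕ}
    (hP : ∀ p ∈ P, (arr p).isSome) : Set.InjOn (rankIn arr P) P := by
  intro p hp q hq h
  obtain ⟨x, hx⟩ := Option.isSome_iff_exists.1 (hP p hp)
  obtain ⟨y, hy⟩ := Option.isSome_iff_exists.1 (hP q hq)
  rcases lt_trichotomy x y with hxy | hxy | hxy
  · exact absurd h (rankIn_lt hp hx hy hxy).ne'
  · exact hdist p q x hx (hxy ▸ hy)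
  · exact absurd h (rankIn_lt hq hy hx hxy).ne

/-- Ranks are injective with values between 1 and the number of packets, so all these values occur.
-/
theorem exists_rankIn_eq (hdist : ∀ s t x, arr s = some x → arr t = some x → s = t)
    {P : Finset ℕ} (hP : ∀ p ∈ P, (arr p).isSome) {r : ℕ} (hr : 0 < r) (hr' : r ≤ P.card) :
    ∃ p ∈ P, rankIn arr P p = r := by
  have h : P.image (rankIn arr P) = Finset.Ico 1 (P.card + 1) := by
    refine Finset.eq_of_subset_of_card_le ?_ ?_
    · intro n hn
      obtain ⟨p, hp, rfl⟩ := Finset.mem_image.1 hn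
      exact Finset.mem_Ico.2 ⟨rankIn_pos hp (hP p hp), Nat.lt_succ_of_le (rankIn_le_card _ _ _)⟩
    · rw [Finset.card_image_of_injOn (rankIn_injOn hdist hP), Nat.card_Ico]
      omega
  have : r ∈ Finset.Ico 1 (P.card + 1) := Finset.mem_Ico.2 ⟨hr, Nat.lt_succ_of_le hr'⟩
  rw [← h] at this
  simpa using this

/-- The packet of rank `r` in `P`, if any. -/
noncomputable def select (arr : ℕ → Option α) (P : Finset ℕ) (r : ℕ) : Option ℕ :=
  (P.filter fun p => rankIn arr P p = r).toList.head?

theorem select_congr {arr arr' : ℕ → Option α} {P : Finset ℕ} (h : ∀ p ∈ P, arr p = arr' p)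
    (r : ℕ) : select arr P r = select arr' P r := by
  simp only [select]
  congr 2
  refine Finset.filter_congr fun p hp => ?_
  rw [rankIn_congr h hp]

theorem mem_of_select {P : Finset ℕ} {r p : ℕ} (h : select arr P r = some p) :
    p ∈ P ∧ rankIn arr P p = r := by
  have := List.mem_of_mem_head? (Option.mem_def.2 h)
  simpa using this

theorem exists_select (hdist : ∀ s t x, arr s = some x → arr t = some x → s = t)
    {P : Finset ℕ} (hP : ∀ p ∈ P, (arr p).isSome) {r : ℕ} (hr : 0 < r) (hr' : r ≤ P.card) :
    ∃ p, select arr P r = some p := by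
  obtain ⟨p, hp, h⟩ := exists_rankIn_eq hdist hP hr hr'
  cases hs : select arr P r with
  | some q => exact ⟨q, rfl⟩
  | none =>
    rw [select, List.head?_eq_none_iff, Finset.toList_eq_nil] at hs
    exact absurd (Finset.mem_filter.2 ⟨hp, h⟩) (hs ▸ Finset.notMem_empty p)

theorem select_eq_none {P : Finset ℕ} {r : ℕ} (h : P.card < r) : select arr P r = none := by
  cases hs : select arr P r with
  | none => rfl
  | some q =>
    have := rankIn_le_card arr P q
    rw [(mem_of_select hs).2] at this
    omega

/-- The packet that departs, if `P` are the packets present and `b` the request. -/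
noncomputable def served (arr : ℕ → Option α) (b : Bool) (P : Finset ℕ) : Option ℕ :=
  if b then select arr P 1 else none

/-- The packet that is lost. -/
noncomputable def dropped (arr : ℕ → Option α) (B : ℕ) (b : Bool) (P : Finset ℕ) : Option ℕ :=
  if b then none else select arr P (B + 1)

/-- The packets that stay in the queue. -/
noncomputable def remaining (arr : ℕ → Option α) (B : ℕ) (b : Bool) (P : Finset ℕ) : Finset ℕ :=
  P.filter fun p => served arr b P ≠ some p ∧ dropped arr B b P ≠ some p

/-- The stored packets together with the arriving packet. -/
def withArrival (arr : ℕ → Option α) (t : ℕ) (Q : Finset ℕ) : Finset ℕ :=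
  if (arr t).isSome then insert t Q else Q

/-- At most one packet leaves per slot. With at most `B + 1` packets present, rank `B + 1` exists
only when there are exactly that many, and then it is the lowest priority. -/
theorem remaining_cases (hdist : ∀ s t x, arr s = some x → arr t = some x → s = t)
    {P : Finset ℕ} (hP : ∀ p ∈ P, (arr p).isSome) {B : ℕ} (hB : P.card ≤ B + 1) (b : Bool) :
    (b = true ∧ P = ∅ ∧ served arr b P = none ∧ dropped arr B b P = none ∧
      remaining arr B b P = P) ∨
    (∃ p ∈ P, b = true ∧ rankIn arr P p = 1 ∧ served arr b P = some p ∧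
      dropped arr B b P = none ∧ remaining arr B b P = P.erase p) ∨
    (b = false ∧ P.card ≤ B ∧ served arr b P = none ∧ dropped arr B b P = none ∧
      remaining arr B b P = P) ∨
    (∃ p ∈ P, b = false ∧ P.card = B + 1 ∧ rankIn arr P p = B + 1 ∧ served arr b P = none ∧
      dropped arr B b P = some p ∧ remaining arr B b P = P.erase p) := by
  have he : ∀ p, P.filter (fun q => some p ≠ some q) = P.erase p := by
    intro p
    ext q
    simp only [Finset.mem_filter, Finset.mem_erase, ne_eq, Option.some.injEq]
    tauto
  cases b
  · right; right
    by_cases h : P.card ≤ B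
    · left
      have hn : select arr P (B + 1) = none := select_eq_none (by omega)
      refine ⟨rfl, h, by simp [served], by simp [dropped, hn], ?_⟩
      simp [remaining, served, dropped, hn]
    · right
      obtain ⟨p, hp⟩ := exists_select hdist hP (r := B + 1) (by omega) (by omega)
      refine ⟨p, (mem_of_select hp).1, rfl, by omega, (mem_of_select hp).2, by simp [served],
        by simp [dropped, hp], ?_⟩
      rw [← he p]
      simp [remaining, served, dropped, hp]
  · rcases P.eq_empty_or_nonempty with h | h
    · left
      have hn : select arr P 1 = none := select_eq_none (by simp [h])
      refine ⟨rfl, h, by simp [served, hn], by simp [dropped], ?_⟩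
      simp [remaining, served, dropped, hn]
    · right; left
      obtain ⟨p, hp⟩ := exists_select hdist hP (r := 1) one_pos (Finset.card_pos.2 h)
      refine ⟨p, (mem_of_select hp).1, rfl, (mem_of_select hp).2, by simp [served, hp],
        by simp [dropped], ?_⟩
      rw [← he p]
      simp [remaining, served, dropped, hp]

/-- The packets in the ideal priority queue at the beginning of every slot. -/
noncomputable def queue (arr : ℕ → Option α) (req : ℕ → Bool) (B : ℕ) : ℕ → Finset ℕ
  | 0 => ∅
  | t + 1 => remaining arr B (req t) (withArrival arr t (queue arr req B t))

/-- The distance of the rank of a packet from the ends of a queue with buffer `B`. -/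
noncomputable def depth (arr : ℕ → Option α) (B : ℕ) (Q : Finset ℕ) (p : ℕ) : ℕ :=
  if p ∈ Q then min (rankIn arr Q p) (B + 1 - rankIn arr Q p) else 0

/-! ### Size of the ideal queue and evolution of the depths. -/

omit [LinearOrder α] in
theorem mem_withArrival {t p : ℕ} {Q : Finset ℕ} :
    p ∈ withArrival arr t Q ↔ p ∈ Q ∨ p = t ∧ (arr t).isSome := by
  simp only [withArrival]
  split_ifs with h <;> simp [h, or_comm]

theorem remaining_subset (arr : ℕ → Option α) (B : ℕ) (b : Bool) (P : Finset ℕ) :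
    remaining arr B b P ⊆ P := Finset.filter_subset _ _

theorem lt_of_mem_queue {req : ℕ → Bool} {B t p : ℕ} (h : p ∈ queue arr req B t) : p < t := by
  induction t with
  | zero => simp [queue] at h
  | succ t ih =>
    rcases mem_withArrival.1 (remaining_subset _ _ _ _ h) with h | h
    · exact (ih h).trans t.lt_succ_self
    · exact h.1 ▸ t.lt_succ_self

theorem isSome_of_mem_queue {req : ℕ → Bool} {B t p : ℕ} (h : p ∈ queue arr req B t) :
    (arr p).isSome := by
  induction t with
  | zero => simp [queue] at h
  | succ t ih =>
    rcases mem_withArrival.1 (remaining_subset _ _ _ _ h) with h | h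
    · exact ih h
    · exact h.1 ▸ h.2

theorem isSome_of_mem_withArrival {req : ℕ → Bool} {B t p : ℕ}
    (h : p ∈ withArrival arr t (queue arr req B t)) : (arr p).isSome := by
  rcases mem_withArrival.1 h with h | h
  · exact isSome_of_mem_queue h
  · exact h.1 ▸ h.2

theorem card_withArrival (req : ℕ → Bool) (B t : ℕ) :
    (withArrival arr t (queue arr req B t)).card =
      (queue arr req B t).card + if (arr t).isSome then 1 else 0 := by
  simp only [withArrival]
  split_ifs
  · exact Finset.card_insert_of_notMem fun h => lt_irrefl t (lt_of_mem_queue h)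
  · rfl

theorem card_queue_le (hdist : ∀ s t x, arr s = some x → arr t = some x → s = t)
    (req : ℕ → Bool) (B t : ℕ) : (queue arr req B t).card ≤ B := by
  induction t with
  | zero => simp [queue]
  | succ t ih =>
    have hc := card_withArrival (arr := arr) req B t
    have hB : (withArrival arr t (queue arr req B t)).card ≤ B + 1 := by
      split_ifs at hc <;> omega
    rw [queue]
    rcases remaining_cases hdist (fun p hp => isSome_of_mem_withArrival hp) hB (req t) with
      ⟨-, h, -, -, h'⟩ | ⟨p, hp, -, -, -, -, h'⟩ | ⟨-, h, -, -, h'⟩ | ⟨p, hp, -, h, -, -, -, h'⟩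
    · rw [h', h]; simp
    · rw [h', Finset.card_erase_of_mem hp]; omega
    · rw [h']; exact h
    · rw [h', Finset.card_erase_of_mem hp]; omega

theorem card_withArrival_le (hdist : ∀ s t x, arr s = some x → arr t = some x → s = t)
    (req : ℕ → Bool) (B t : ℕ) : (withArrival arr t (queue arr req B t)).card ≤ B + 1 := by
  have hc := card_withArrival (arr := arr) req B t
  have := card_queue_le hdist req B t
  split_ifs at hc <;> omega

/-- Depth below `x` leaves only the ranks `1, …, x - 1` and the ranks from `B + 2 - x` to `B`, and
different packets have different ranks. -/
theorem card_depth_lt (hdist : ∀ s t x, arr s = some x → arr t = some x → s = t)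
    {B : ℕ} {Q : Finset ℕ} (hQ : ∀ p ∈ Q, (arr p).isSome) (hB : Q.card ≤ B) (x : ℕ) :
    (Q.filter fun p => depth arr B Q p < x).card ≤ 2 * (x - 1) := by
  have h : (Q.filter fun p => depth arr B Q p < x).card ≤
      (Finset.Ico 1 x ∪ Finset.Ico (B + 2 - x) (B + 1)).card := by
    refine Finset.card_le_card_of_injOn (rankIn arr Q) ?_ ?_
    · intro p hp
      obtain ⟨hp, hd⟩ := Finset.mem_filter.1 (Finset.mem_coe.1 hp)
      rw [depth, if_pos hp] at hd
      have h1 := rankIn_pos hp (hQ p hp)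
      have h2 := rankIn_le_card arr Q p
      simp only [Finset.coe_union, Finset.coe_Ico, Set.mem_union, Set.mem_Ico]
      omega
    · exact (rankIn_injOn hdist hQ).mono fun p hp =>
        (Finset.mem_filter.1 (Finset.mem_coe.1 hp)).1
  have h' := h.trans (Finset.card_union_le _ _)
  rw [Nat.card_Ico, Nat.card_Ico] at h'
  omega

/-- Both the old and the new queue arise from the set `P` of packets present by removing at most one
packet, so ranks, and with them depths, move by at most one. A packet that leaves has rank 1 or `B +
1` in `P`, hence rank at most 1 or at least `B` in the old queue. The bound on `B` is used because
depths are at most half of `B + 1`. -/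
theorem depthProcess_queue (hdist : ∀ s t x, arr s = some x → arr t = some x → s = t)
    (req : ℕ → Bool) {B c J : ℕ} (hc : 0 < c) (hc2 : c ≤ 2) (hB : B + 1 < 2 * (c * 4 ^ (J + 1))) :
    DepthProcess c J (queue arr req B) fun t => depth arr B (queue arr req B t) where
  pos := hc
  le_two := hc2
  zero := rfl
  step t := by
    set Q := queue arr req B t with hQ
    set P := withArrival arr t Q with hP
    have hQP : Q ⊆ P := fun p hp => mem_withArrival.2 (Or.inl hp)
    have hQ'P : queue arr req B (t + 1) ⊆ P := remaining_subset _ _ _ _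
    have hcP : P.card = Q.card + if (arr t).isSome then 1 else 0 := card_withArrival req B t
    have hcQ : Q.card ≤ B := card_queue_le hdist req B t
    have hcQ' := card_queue_le hdist req B (t + 1)
    have h1 : (P \ Q).card ≤ 1 := by
      rw [Finset.card_sdiff_of_subset hQP]
      split_ifs at hcP <;> omega
    have hQ' : queue arr req B (t + 1) = remaining arr B (req t) P := rfl
    have hcases := remaining_cases hdist (P := P) (fun p hp => isSome_of_mem_withArrival hp)
      (card_withArrival_le hdist req B t) (req t)
    have h2 : (P \ queue arr req B (t + 1)).card ≤ 1 := by
      rw [hQ']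
      rcases hcases with
        ⟨-, -, -, -, h'⟩ | ⟨p, hp, -, -, -, -, h'⟩ | ⟨-, -, -, -, h'⟩ | ⟨p, hp, -, -, -, -, -, h'⟩
      all_goals rw [h']
      · simp
      · rw [Finset.sdiff_erase_self hp]; simp
      · simp
      · rw [Finset.sdiff_erase_self hp]; simp
    refine ⟨fun p hp => lt_of_mem_queue hp, ?_, ?_, ?_, ?_, ?_, ?_, ?_⟩
    · intro p hp hpt
      exact (mem_withArrival.1 (hQ'P hp)).resolve_right fun h => hpt h.1
    · intro p hp hp'
      simp only [depth, if_pos hp, if_pos hp']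
      have a1 := rankIn_mono arr hQP p
      have a2 := rankIn_le_add arr Q P p
      have a3 := rankIn_mono arr hQ'P p
      have a4 := rankIn_le_add arr (queue arr req B (t + 1)) P p
      omega
    · intro p hp hp'
      simp only [depth, if_pos hp, if_pos hp']
      have a1 := rankIn_mono arr hQP p
      have a2 := rankIn_le_add arr Q P p
      have a3 := rankIn_mono arr hQ'P p
      have a4 := rankIn_le_add arr (queue arr req B (t + 1)) P p
      omega
    · intro p hp hp'
      simp only [depth, if_pos hp]
      have a1 := rankIn_mono arr hQP p
      have a2 := rankIn_le_add arr Q P p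
      rw [hQ'] at hp'
      rcases hcases with
        ⟨-, -, -, -, h'⟩ | ⟨q, hq, -, hr, -, -, h'⟩ | ⟨-, -, -, -, h'⟩ |
          ⟨q, hq, -, -, hr, -, -, h'⟩
      · exact absurd (by rw [h']; exact hQP hp) hp'
      · obtain rfl : p = q := by
          by_contra hne
          exact hp' (h' ▸ Finset.mem_erase.2 ⟨hne, hQP hp⟩)
        omega
      · exact absurd (by rw [h']; exact hQP hp) hp'
      · obtain rfl : p = q := by
          by_contra hne
          exact hp' (h' ▸ Finset.mem_erase.2 ⟨hne, hQP hp⟩)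
        omega
    · exact card_depth_lt hdist (fun p hp => isSome_of_mem_queue hp) hcQ
    · exact card_depth_lt hdist (fun p hp => isSome_of_mem_queue hp) hcQ'
    · intro p hp
      simp only [depth, if_pos hp]
      omega

/-- The ideal priority queue as a queueing element. -/
noncomputable def idealTrace (arr : ℕ → Option α) (req : ℕ → Bool) (B : ℕ) : QueueTrace α where
  arrival := arr
  request := req
  departure t := served arr (req t) (withArrival arr t (queue arr req B t))
  loss t := dropped arr B (req t) (withArrival arr t (queue arr req B t))
  stored t := queue arr req B t

theorem idealTrace_rank (arr : ℕ → Option α) (req : ℕ → Bool) (B t i : ℕ) :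
    (idealTrace arr req B).rank t i = rankIn arr (withArrival arr t (queue arr req B t)) i := by
  classical
  rw [rankIn, ← Set.ncard_coe_finset]
  rw [QueueTrace.rank]
  congr 1
  ext k
  simp only [QueueTrace.present, QueueTrace.AtLeast, idealTrace, Finset.coe_filter,
    mem_withArrival, Set.mem_union, Finset.mem_coe, Set.mem_ofPred_eq]

theorem idealTrace_isPriorityQueue (hdist : ∀ s t x, arr s = some x → arr t = some x → s = t)
    (req : ℕ → Bool) (B : ℕ) : (idealTrace arr req B).IsPriorityQueue B := by
  have hq : ∀ t, (idealTrace arr req B).q t = (queue arr req B t).card := fun t => by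
    simp [QueueTrace.q, idealTrace]
  have hcard : ∀ t, ((withArrival arr t (queue arr req B t)).card : ℤ) =
      (idealTrace arr req B).q t + (idealTrace arr req B).a t := fun t => by
    rw [card_withArrival, hq]
    simp only [QueueTrace.a, idealTrace, linkState]
    rw [Nat.cast_add]
    split_ifs with h <;> simp [h]
  have ha : ∀ t, (idealTrace arr req B).a t = 0 ∨ (idealTrace arr req B).a t = 1 := fun t => by
    simp only [QueueTrace.a, linkState]
    split_ifs <;> simp
  have hB : ∀ t, (idealTrace arr req B).q t ≤ B := fun t => by
    rw [hq]; exact_mod_cast card_queue_le hdist req B t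
  have hq0 : ∀ t, 0 ≤ (idealTrace arr req B).q t := fun t => by rw [hq]; positivity
  have main : ∀ t,
      (idealTrace arr req B).q (t + 1) = (idealTrace arr req B).q t + (idealTrace arr req B).a t -
          (idealTrace arr req B).d t - (idealTrace arr req B).l t ∧
      ((idealTrace arr req B).d t = if req t = true ∧
          0 < (idealTrace arr req B).q t + (idealTrace arr req B).a t then 1 else 0) ∧
      ((idealTrace arr req B).l t = if req t = false ∧ (idealTrace arr req B).q t = B ∧
          (idealTrace arr req B).a t = 1 then 1 else 0) ∧
      (idealTrace arr req B).l t = max ((idealTrace arr req B).q t + (idealTrace arr req B).a t -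
          (idealTrace arr req B).d t - B) 0 := by
    intro t
    have h1 := hcard t
    have h2 := ha t
    have h3 := hB t
    have h4 := hq0 t
    have hd : (idealTrace arr req B).d t =
        linkState (served arr (req t) (withArrival arr t (queue arr req B t))) := rfl
    have hl : (idealTrace arr req B).l t =
        linkState (dropped arr B (req t) (withArrival arr t (queue arr req B t))) := rfl
    rw [hq (t + 1), queue]
    rcases remaining_cases hdist (fun p hp => isSome_of_mem_withArrival hp)
      (card_withArrival_le hdist req B t) (req t) with
      ⟨hb, h, hs, hdr, h'⟩ | ⟨q, hm, hb, hr, hs, hdr, h'⟩ | ⟨hb, h, hs, hdr, h'⟩ |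
        ⟨q, hm, hb, h, hr, hs, hdr, h'⟩
    all_goals
      rw [hs] at hd
      rw [hdr] at hl
      simp only [linkState, Option.isSome_none, Option.isSome_some, Bool.false_eq_true, if_false,
        if_true] at hd hl
      rw [h', hd, hl, hb]
    · rw [h, Finset.card_empty, Nat.cast_zero] at h1
      rw [h, Finset.card_empty]
      refine ⟨by simp; omega, by rw [if_neg]; omega, by simp, by omega⟩
    · have := Finset.card_pos.2 ⟨q, hm⟩
      rw [Finset.card_erase_of_mem hm]
      refine ⟨by omega, by rw [if_pos]; exact ⟨rfl, by omega⟩, by simp, by omega⟩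
    · refine ⟨by omega, by simp, by rw [if_neg]; omega, by omega⟩
    · rw [Finset.card_erase_of_mem hm]
      refine ⟨by omega, by simp, by rw [if_pos]; exact ⟨rfl, by omega⟩, by omega⟩
  have hpres : ∀ t i, i ∈ withArrival arr t (queue arr req B t) →
      i ∈ (idealTrace arr req B).present t := fun t i h => by
    simpa [QueueTrace.present, idealTrace] using mem_withArrival.1 h
  refine ⟨fun t => (main t).1, fun t => (main t).2.1, fun t => (main t).2.2.1,
    fun t => (main t).2.2.2, ?_, ?_⟩
  · intro t i h
    rw [idealTrace_rank]
    simp only [idealTrace, served] at h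
    split_ifs at h
    exact ⟨hpres t i (mem_of_select h).1, (mem_of_select h).2⟩
  · intro t i h
    rw [idealTrace_rank]
    simp only [idealTrace, dropped] at h
    split_ifs at h
    exact ⟨hpres t i (mem_of_select h).1, (mem_of_select h).2⟩

/-- The queue depends only on the past. -/
theorem queue_congr {arr arr' : ℕ → Option α} {req req' : ℕ → Bool} {t : ℕ}
    (ha : ∀ s < t, arr s = arr' s) (hr : ∀ s < t, req s = req' s) (B : ℕ) :
    queue arr req B t = queue arr' req' B t := by
  induction t with
  | zero => rfl
  | succ t ih =>
    rw [queue, queue, ih (fun s hs => ha s (by omega)) (fun s hs => hr s (by omega)),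
      hr t t.lt_succ_self]
    have hw : withArrival arr t (queue arr' req' B t) = withArrival arr' t (queue arr' req' B t) := by
      rw [withArrival, withArrival, ha t t.lt_succ_self]
    rw [hw]
    have hP : ∀ p ∈ withArrival arr' t (queue arr' req' B t), arr p = arr' p := by
      intro p hp
      rcases mem_withArrival.1 hp with h | h
      · exact ha p ((lt_of_mem_queue h).trans t.lt_succ_self)
      · exact h.1 ▸ ha t t.lt_succ_self
    refine Finset.filter_congr fun p _ => ?_
    rw [served, served, dropped, dropped, select_congr hP, select_congr hP]

end Rank

end PriorityQueueNetwork

/-! ## The network -/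

namespace PriorityQueueNetwork

/-- A delay element of a class: a switch with delay lines `1, 2, 4, …` fed back. -/
abbrev Cluster (J : ℕ) : Type := Fin J × Fin 48

/-- The number of delay lines of a delay element. -/
def width (b : ℕ) {J : ℕ} (k : Cluster J) : ℕ := 2 * (k.1 + 1) + b

/-- The number of a delay element. -/
def index {J : ℕ} (k : Cluster J) : ℕ := 48 * k.1 + k.2

theorem index_inj {J : ℕ} {k l : Cluster J} (h : index k = index l) : k = l := by
  obtain ⟨⟨i, hi⟩, ⟨q, hq⟩⟩ := k
  obtain ⟨⟨i', hi'⟩, ⟨q', hq'⟩⟩ := l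
  simp only [index] at h
  obtain rfl : i = i' := by omega
  obtain rfl : q = q' := by omega
  rfl

/-- The main switch, the delay elements and some idle switches. -/
abbrev SwitchIndex (J : ℕ) (R : Multiset ℕ) : Type := Option (Cluster J ⊕ R.ToType)

/-- The sizes of the switches. -/
def switchSize (b J M : ℕ) (R : Multiset ℕ) : SwitchIndex J R → ℕ
  | none => M
  -- Half of the elements of a class get a spare port: 24 switches are needed of each of two
  -- consecutive sizes, in accordance with the supply.
  | some (.inl k) => width b k + 1 + k.2 / 24
  | some (.inr r) => r.1

/-- Lines of delay 1 at the main switch, the lines of the delay elements, and some idle lines. -/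
abbrev LineIndex (b J r : ℕ) : Type := Fin 14 ⊕ (Σ k : Cluster J, Fin (width b k)) ⊕ Fin r

/-- The delays of the lines. -/
def lineDelay (b J r : ℕ) : LineIndex b J r → ℕ
  | .inl _ => 1
  | .inr (.inl ⟨_, s⟩) => 2 ^ (s : ℕ)
  | .inr (.inr _) => 0

/-- The links of the network. -/
inductive Link (b J M r : ℕ) (R : Multiset ℕ) :
    Outlet (SwitchIndex J R) (switchSize b J M R) (LineIndex b J r) →
    Inlet (SwitchIndex J R) (switchSize b J M R) (LineIndex b J r) → Prop
  -- Inputs of the main switch: 0 for the arrival, 1 to 14 for the unit lines, then the elements.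
  -- Outputs are shifted by one more, since 0 and 1 are the departure and the loss. Hence `16 + 48 *
  -- J` ports suffice.
  | arrival (i : Fin (switchSize b J M R none)) (hi : i.val = 0) :
      Link b J M r R .input (.toSwitch none i)
  | departure (o : Fin (switchSize b J M R none)) (ho : o.val = 0) :
      Link b J M r R (.ofSwitch none o) .departure
  | loss (o : Fin (switchSize b J M R none)) (ho : o.val = 1) :
      Link b J M r R (.ofSwitch none o) .loss
  | shortIn (n : Fin 14) (o : Fin (switchSize b J M R none)) (ho : o.val = 2 + n.val) :
      Link b J M r R (.ofSwitch none o) (.toLine (.inl n))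
  | shortOut (n : Fin 14) (i : Fin (switchSize b J M R none)) (hi : i.val = 1 + n.val) :
      Link b J M r R (.ofLine (.inl n)) (.toSwitch none i)
  | clusterIn (k : Cluster J) (o : Fin (switchSize b J M R none))
      (i : Fin (switchSize b J M R (some (.inl k)))) (ho : o.val = 16 + index k) (hi : i.val = 0) :
      Link b J M r R (.ofSwitch none o) (.toSwitch (some (.inl k)) i)
  | clusterOut (k : Cluster J) (o : Fin (switchSize b J M R (some (.inl k))))
      (i : Fin (switchSize b J M R none)) (ho : o.val = 0) (hi : i.val = 15 + index k) :
      Link b J M r R (.ofSwitch (some (.inl k)) o) (.toSwitch none i)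
  | lineIn (k : Cluster J) (s : Fin (width b k)) (o : Fin (switchSize b J M R (some (.inl k))))
      (ho : o.val = s.val + 1) :
      Link b J M r R (.ofSwitch (some (.inl k)) o) (.toLine (.inr (.inl ⟨k, s⟩)))
  | lineOut (k : Cluster J) (s : Fin (width b k)) (i : Fin (switchSize b J M R (some (.inl k))))
      (hi : i.val = s.val + 1) :
      Link b J M r R (.ofLine (.inr (.inl ⟨k, s⟩))) (.toSwitch (some (.inl k)) i)

section Wiring

variable {b J M r : ℕ} {R : Multiset ℕ}

theorem Link.left_unique {x x' y} (h : Link b J M r R x y) (h' : Link b J M r R x' y) :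
    x = x' := by
  cases h <;> cases h' <;> first
    | rfl
    | (exfalso; omega)
    | (congr 1; apply Fin.ext; omega)
    | (congr 2; apply Fin.ext; omega)
    | skip
  case clusterOut.clusterOut k o i ho hi k' o' ho' hi' =>
    obtain rfl := index_inj (k := k) (l := k') (by omega)
    congr 1
    exact Fin.ext (by omega)
  case lineOut.lineOut k s i hi s' hi' =>
    obtain rfl : s = s' := Fin.ext (by omega)
    rfl

theorem Link.right_unique {x y y'} (h : Link b J M r R x y) (h' : Link b J M r R x y') :
    y = y' := by
  cases h <;> cases h' <;> first
    | rfl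
    | (exfalso; omega)
    | (congr 1; apply Fin.ext; omega)
    | (congr 2; apply Fin.ext; omega)
    | skip
  case clusterIn.clusterIn k o i ho hi k' i' hi' ho' =>
    obtain rfl := index_inj (k := k) (l := k') (by omega)
    congr 1
    exact Fin.ext (by omega)
  case lineIn.lineIn k s o ho s' ho' =>
    obtain rfl : s = s' := Fin.ext (by omega)
    rfl

end Wiring

open Classical in
/-- The network. -/
noncomputable def network (b J M r : ℕ) (R : Multiset ℕ) : SDLNetwork where
  Switch := SwitchIndex J R
  Line := LineIndex b J r
  size := switchSize b J M R
  delay := lineDelay b J r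
  wire y := if h : ∃ x, Link b J M r R x y then some h.choose else none
  wire_inj y y' x h h' := by
    split_ifs at h with hy
    split_ifs at h' with hy'
    cases h
    have := Option.some.inj h'
    exact hy.choose_spec.right_unique (this ▸ hy'.choose_spec)

theorem network_wire {b J M r : ℕ} {R : Multiset ℕ}
    {y : Inlet (SwitchIndex J R) (switchSize b J M R) (LineIndex b J r)}
    {x : Outlet (SwitchIndex J R) (switchSize b J M R) (LineIndex b J r)} :
    (network b J M r R).wire y = some x ↔ Link b J M r R x y := by
  simp only [network]
  split_ifs with h
  · rw [Option.some.injEq]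
    exact ⟨fun e => e ▸ h.choose_spec, fun hx => h.choose_spec.left_unique hx⟩
  · simp only [false_iff]
    exact fun hx => h ⟨x, hx⟩

end PriorityQueueNetwork

/-! ## Routing -/

namespace PriorityQueueNetwork

/-- The part of the history that determines the settings of the switches in slot `slot`. -/
structure Snapshot where
  slot : ℕ
  arrived : Bool
  departure : Option ℕ
  loss : Option ℕ
  before : Finset ℕ
  after : Finset ℕ
  flightBefore : ℕ → Flight
  flightAfter : ℕ → Flight

/-- The port of the main switch, up to a shift, that serves a flight. -/
def Flight.port (f : Flight) : ℕ := if f.cls = 0 then f.pos else 14 + (48 * (f.cls - 1) + f.pos % 48)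

/-- The flight uses the given delay element. -/
def Flight.Uses {J : ℕ} (f : Flight) (k : Cluster J) : Prop :=
  f.cls = k.1 + 1 ∧ f.pos % 48 = k.2

/-- The delay of a flight. -/
def Flight.delay (f : Flight) : ℕ := f.out - f.start

namespace Snapshot

/-- Packet `p` is at input `i` of the main switch. -/
def MainIn (s : Snapshot) (p i : ℕ) : Prop :=
  (i = 0 ∧ p = s.slot ∧ s.arrived = true) ∨
    (p ∈ s.before ∧ (s.flightBefore p).out = s.slot ∧ i = 1 + (s.flightBefore p).port)

/-- Packet `p` is routed to output `o` of the main switch. -/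
def MainOut (s : Snapshot) (p o : ℕ) : Prop :=
  (s.departure = some p ∧ o = 0) ∨ (s.loss = some p ∧ o = 1) ∨
    (p ∈ s.after ∧ (s.flightAfter p).start = s.slot ∧ o = 2 + (s.flightAfter p).port)

/-- A packet on a flight is at input `i` of delay element `k`. -/
def ClusterIn {J : ℕ} (s : Snapshot) (k : Cluster J) (x : ℕ × Flight) (i : ℕ) : Prop :=
  x.2.Uses k ∧
    ((i = 0 ∧ x.1 ∈ s.after ∧ s.flightAfter x.1 = x.2 ∧ x.2.start = s.slot) ∨
      ∃ e, i = e + 1 ∧ x.1 ∈ s.before ∧ s.flightBefore x.1 = x.2 ∧ x.2.delay.testBit e = true ∧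
        s.slot = x.2.start + x.2.delay % 2 ^ (e + 1))

/-- A packet on a flight is routed to output `o` of delay element `k`. -/
def ClusterOut {J : ℕ} (s : Snapshot) (k : Cluster J) (x : ℕ × Flight) (o : ℕ) : Prop :=
  x.2.Uses k ∧
    ((o = 0 ∧ x.1 ∈ s.before ∧ s.flightBefore x.1 = x.2 ∧ x.2.out = s.slot) ∨
      ∃ e, o = e + 1 ∧ x.1 ∈ s.after ∧ s.flightAfter x.1 = x.2 ∧ x.2.delay.testBit e = true ∧
        s.slot = x.2.start + x.2.delay % 2 ^ e)

end Snapshot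

open Classical in
/-- A permutation that routes everything from the inputs `I` to the outputs `O`. -/
noncomputable def routingPerm {τ : Type*} {n : ℕ} (I O : τ → ℕ → Prop) : Equiv.Perm (Fin n) :=
  if h : ∃ g : Equiv.Perm (Fin n), ∀ (x : τ) (i o : Fin n), I x i → O x o → g i = o then h.choose
  else 1

theorem routingPerm_spec {τ : Type*} {n : ℕ} {I O : τ → ℕ → Prop}
    (hI : ∀ x i i', I x i → I x i' → i = i') (hI' : ∀ x x' i, I x i → I x' i → x = x')
    (hO : ∀ x i i', O x i → O x i' → i = i') (hO' : ∀ x x' i, O x i → O x' i → x = x')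
    {x : τ} {i o : Fin n} (hi : I x i) (ho : O x o) : routingPerm I O i = o := by
  have h : ∃ g : Equiv.Perm (Fin n), ∀ (x : τ) (i o : Fin n), I x i → O x o → g i = o :=
    exists_perm_extending (fun x (i : Fin n) => I x i) (fun x (i : Fin n) => O x i)
      (fun x i i' h h' => Fin.ext (hI x i i' h h')) (fun x x' i h h' => hI' x x' i h h')
      (fun x i i' h h' => Fin.ext (hO x i i' h h')) (fun x x' i h h' => hO' x x' i h h')
  rw [routingPerm, dif_pos h]
  exact h.choose_spec x i o hi ho

/-- The settings of the switches. -/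
noncomputable def Snapshot.setting (b J M r : ℕ) (R : Multiset ℕ) (s : Snapshot) :
    (network b J M r R).Setting
  | none => routingPerm s.MainIn s.MainOut
  | some (.inl k) => routingPerm (s.ClusterIn k) (s.ClusterOut k)
  | some (.inr _) => 1

/-- The movements of packets through the network, together with the packets that arrive, depart and
are lost. -/
structure Run (b J : ℕ) (Q : ℕ → Finset ℕ) (D : ℕ → ℕ → ℕ) (arrived : ℕ → Bool)
    (departure loss : ℕ → Option ℕ) : Prop extends DepthProcess (2 ^ b) J Q D where
  arrived_of_mem : ∀ t, t ∈ Q (t + 1) → arrived t = true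
  ended : ∀ t p, p ∈ Q t ∨ p = t ∧ arrived t = true → p ∉ Q (t + 1) →
    departure t = some p ∨ loss t = some p
  of_departure : ∀ t p, departure t = some p → p ∉ Q (t + 1) ∧ loss t ≠ some p ∧
    (p ∈ Q t ∨ p = t ∧ arrived t = true)
  of_loss : ∀ t p, loss t = some p → p ∉ Q (t + 1) ∧ departure t ≠ some p ∧
    (p ∈ Q t ∨ p = t ∧ arrived t = true)

/-- The snapshot of a run in slot `t`. -/
noncomputable def snapshot (b : ℕ) (Q : ℕ → Finset ℕ) (D : ℕ → ℕ → ℕ) (arrived : ℕ → Bool)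
    (departure loss : ℕ → Option ℕ) (t : ℕ) : Snapshot where
  slot := t
  arrived := arrived t
  departure := departure t
  loss := loss t
  before := Q t
  after := Q (t + 1)
  flightBefore := (schedule (2 ^ b) Q D t).flight
  flightAfter := (schedule (2 ^ b) Q D (t + 1)).flight

theorem Flight.port_eq {f g : Flight} (hf : f.cls = 0 → f.pos < 14) (hg : g.cls = 0 → g.pos < 14)
    (h : f.port = g.port) : f.cls = g.cls ∧ f.pos % 48 = g.pos % 48 ∧ (f.cls = 0 → f.pos = g.pos) := by
  simp only [Flight.port] at h
  split_ifs at h with h1 h2 h2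
  · have := hf h1
    have := hg h2
    omega
  · have := hf h1
    omega
  · have := hg h2
    omega
  · omega

namespace Run

variable {b J : ℕ} {Q : ℕ → Finset ℕ} {D : ℕ → ℕ → ℕ} {arrived : ℕ → Bool}
  {departure loss : ℕ → Option ℕ}

theorem delay_pos (H : Run b J Q D arrived departure loss) {t p : ℕ} (hp : p ∈ Q t) :
    0 < ((schedule (2 ^ b) Q D t).flight p).delay :=
  Nat.sub_pos_of_lt (H.start_lt_out hp)

theorem start_add_delay (H : Run b J Q D arrived departure loss) {t p : ℕ} (hp : p ∈ Q t) :
    ((schedule (2 ^ b) Q D t).flight p).start + ((schedule (2 ^ b) Q D t).flight p).delay = ((schedule (2 ^ b) Q D t).flight p).out :=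
  Nat.add_sub_cancel' (H.start_lt_out hp).le

theorem delay_lt_width (H : Run b J Q D arrived departure loss) {t p : ℕ} (hp : p ∈ Q t)
    {k : Cluster J} (hk : ((schedule (2 ^ b) Q D t).flight p).Uses k) : ((schedule (2 ^ b) Q D t).flight p).delay < 2 ^ width b k := by
  have h := H.delay_lt hp hk.1
  have e : (4 : ℕ) ^ (k.1.val + 1) = 2 ^ (2 * (k.1.val + 1)) := by rw [pow_mul]; norm_num
  rwa [e, ← pow_add, add_comm b] at h

theorem lt_width_of_testBit (H : Run b J Q D arrived departure loss) {t p e : ℕ} (hp : p ∈ Q t)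
    {k : Cluster J} (hk : ((schedule (2 ^ b) Q D t).flight p).Uses k) (he : ((schedule (2 ^ b) Q D t).flight p).delay.testBit e = true) :
    e < width b k := by
  by_contra h
  have h1 := (H.delay_lt_width hp hk).trans_le (Nat.pow_le_pow_right two_pos (not_lt.1 h))
  rw [Nat.testBit_lt_two_pow h1] at he
  exact Bool.false_ne_true he

theorem cluster_unique (H : Run b J Q D arrived departure loss) {t p q e : ℕ} {k : Cluster J}
    (hp : p ∈ Q t) (hq : q ∈ Q t) (hk : ((schedule (2 ^ b) Q D t).flight p).Uses k) (hk' : ((schedule (2 ^ b) Q D t).flight q).Uses k)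
    (h : ((schedule (2 ^ b) Q D t).flight p).start + ((schedule (2 ^ b) Q D t).flight p).delay % 2 ^ e = ((schedule (2 ^ b) Q D t).flight q).start + ((schedule (2 ^ b) Q D t).flight q).delay % 2 ^ e) :
    p = q :=
  H.no_conflict hp hq hk.1 hk'.1 (hk.2.trans hk'.2.symm) h

/-- In a positive class the exit slot gives `pos / 16` and the port gives `pos % 48`, which together
determine the position. -/
theorem eq_of_port_eq_of_out_eq (H : Run b J Q D arrived departure loss) {t p q : ℕ}
    (hp : p ∈ Q t) (hq : q ∈ Q t) (h : ((schedule (2 ^ b) Q D t).flight p).port = ((schedule (2 ^ b) Q D t).flight q).port)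
    (ho : ((schedule (2 ^ b) Q D t).flight p).out = ((schedule (2 ^ b) Q D t).flight q).out) : p = q := by
  obtain ⟨h1, h2, h3⟩ := Flight.port_eq ((H.valid t).pos_lt_of_zero p hp)
    ((H.valid t).pos_lt_of_zero q hq) h
  refine (H.valid t).pos_inj p hp q hq h1 ?_
  by_cases h0 : ((schedule (2 ^ b) Q D t).flight p).cls = 0
  · exact h3 h0
  · have h0' : ((schedule (2 ^ b) Q D t).flight q).cls ≠ 0 := fun h => h0 (h1.trans h)
    simp only [Flight.out, if_neg h0, if_neg h0'] at ho
    omega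

/-- In a positive class this is the case `s = 0` of `no_conflict`: meeting at the entrance of an
element. -/
theorem eq_of_port_eq_of_start_eq (H : Run b J Q D arrived departure loss) {t p q : ℕ}
    (hp : p ∈ Q t) (hq : q ∈ Q t) (h : ((schedule (2 ^ b) Q D t).flight p).port = ((schedule (2 ^ b) Q D t).flight q).port)
    (ho : ((schedule (2 ^ b) Q D t).flight p).start = ((schedule (2 ^ b) Q D t).flight q).start) : p = q := by
  obtain ⟨h1, h2, h3⟩ := Flight.port_eq ((H.valid t).pos_lt_of_zero p hp)
    ((H.valid t).pos_lt_of_zero q hq) h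
  rcases hj : ((schedule (2 ^ b) Q D t).flight p).cls with _ | j
  · exact (H.valid t).pos_inj p hp q hq h1 (h3 hj)
  · exact H.no_conflict (s := 0) hp hq hj (h1.symm.trans hj) h2
      (by simp only [pow_zero, Nat.mod_one, add_zero]; exact ho)

/-! ### Nothing collides -/

theorem mainIn_left (H : Run b J Q D arrived departure loss) (t : ℕ) {p i i' : ℕ}
    (h : (snapshot b Q D arrived departure loss t).MainIn p i) (h' : (snapshot b Q D arrived departure loss t).MainIn p i') : i = i' := by
  simp only [Snapshot.MainIn, snapshot] at h h'
  have hlt := (H.step t).lt p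
  rcases h with h | h <;> rcases h' with h' | h'
  · omega
  · have := hlt h'.1
    omega
  · have := hlt h.1
    omega
  · omega

theorem mainIn_right (H : Run b J Q D arrived departure loss) (t : ℕ) {p p' i : ℕ}
    (h : (snapshot b Q D arrived departure loss t).MainIn p i) (h' : (snapshot b Q D arrived departure loss t).MainIn p' i) : p = p' := by
  simp only [Snapshot.MainIn, snapshot] at h h'
  rcases h with h | ⟨h1, h2, h3⟩ <;> rcases h' with h' | ⟨h1', h2', h3'⟩
  · omega
  · omega
  · omega
  · exact H.eq_of_port_eq_of_out_eq h1 h1' (Nat.add_left_cancel (h3.symm.trans h3'))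
      (h2.trans h2'.symm)

theorem mainOut_left (H : Run b J Q D arrived departure loss) (t : ℕ) {p o o' : ℕ}
    (h : (snapshot b Q D arrived departure loss t).MainOut p o) (h' : (snapshot b Q D arrived departure loss t).MainOut p o') : o = o' := by
  simp only [Snapshot.MainOut, snapshot] at h h'
  have h1 := H.of_departure t p
  have h2 := H.of_loss t p
  rcases h with h | h | h <;> rcases h' with h' | h' | h'
  · omega
  · exact absurd h'.1 (h1 h.1).2.1
  · exact absurd h'.1 (h1 h.1).1
  · exact absurd h'.1 (h2 h.1).2.1
  · omega
  · exact absurd h'.1 (h2 h.1).1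
  · exact absurd h.1 (h1 h'.1).1
  · exact absurd h.1 (h2 h'.1).1
  · omega

theorem mainOut_right (H : Run b J Q D arrived departure loss) (t : ℕ) {p p' o : ℕ}
    (h : (snapshot b Q D arrived departure loss t).MainOut p o) (h' : (snapshot b Q D arrived departure loss t).MainOut p' o) : p = p' := by
  simp only [Snapshot.MainOut, snapshot] at h h'
  rcases h with h | h | ⟨h1, h2, h3⟩ <;> rcases h' with h' | h' | ⟨h1', h2', h3'⟩
  · exact Option.some.inj (h.1.symm.trans h'.1)
  · omega
  · omega
  · omega
  · exact Option.some.inj (h.1.symm.trans h'.1)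
  · omega
  · omega
  · omega
  · exact H.eq_of_port_eq_of_start_eq h1 h1' (Nat.add_left_cancel (h3.symm.trans h3'))
      (h2.trans h2'.symm)

/-- What is routed is a packet together with a flight: a packet may end one flight and begin the
next in the same element and slot, passing its switch twice. For a fixed flight the elapsed time
determines the input, as partial sums after set bits are positive and distinct. -/
theorem clusterIn_left (t : ℕ) (k : Cluster J) {x : ℕ × Flight} {i i' : ℕ}
    (h : (snapshot b Q D arrived departure loss t).ClusterIn k x i) (h' : (snapshot b Q D arrived departure loss t).ClusterIn k x i') : i = i' := by
  simp only [Snapshot.ClusterIn, snapshot] at h h'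
  have key : ∀ e, x.2.delay.testBit e = true → 0 < x.2.delay % 2 ^ (e + 1) := fun e he => by
    rw [mod_two_pow_succ_of_testBit he]; positivity
  rcases h with ⟨-, h | ⟨e, h1, -, -, h2, h3⟩⟩ <;>
    rcases h' with ⟨-, h' | ⟨e', h1', -, -, h2', h3'⟩⟩
  · omega
  · have := key e' h2'
    omega
  · have := key e h2
    omega
  · rw [h1, h1', eq_of_mod_two_pow_succ_eq h2 h2' (by omega)]

theorem clusterIn_right (H : Run b J Q D arrived departure loss) (t : ℕ) (k : Cluster J)
    {x x' : ℕ × Flight} {i : ℕ} (h : (snapshot b Q D arrived departure loss t).ClusterIn k x i) (h' : (snapshot b Q D arrived departure loss t).ClusterIn k x' i) :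
    x = x' := by
  obtain ⟨p, f⟩ := x
  obtain ⟨p', f'⟩ := x'
  simp only [Snapshot.ClusterIn, snapshot] at h h'
  rcases h with ⟨hk, ⟨h0, h1, rfl, h2⟩ | ⟨e, h0, h1, rfl, h2, h3⟩⟩ <;>
    rcases h' with ⟨hk', ⟨h0', h1', rfl, h2'⟩ | ⟨e', h0', h1', rfl, h2', h3'⟩⟩
  · obtain rfl := H.cluster_unique (e := 0) h1 h1' hk hk'
      (by simp only [pow_zero, Nat.mod_one, add_zero]; omega)
    rfl
  · omega
  · omega
  · obtain rfl : e = e' := by omega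
    obtain rfl := H.cluster_unique h1 h1' hk hk' (h3.symm.trans h3')
    rfl

theorem clusterOut_left (H : Run b J Q D arrived departure loss) (t : ℕ) (k : Cluster J)
    {x : ℕ × Flight} {o o' : ℕ}
    (h : (snapshot b Q D arrived departure loss t).ClusterOut k x o) (h' : (snapshot b Q D arrived departure loss t).ClusterOut k x o') : o = o' := by
  obtain ⟨p, f⟩ := x
  simp only [Snapshot.ClusterOut, snapshot] at h h'
  have key : ∀ t, p ∈ Q t → (schedule (2 ^ b) Q D t).flight p = f →
      ∀ e, f.delay.testBit e = true → f.start + f.delay % 2 ^ e < f.out := by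
    rintro t hp rfl e he
    have h1 := mod_two_pow_lt_of_testBit he e.lt_succ_self
    have h2 := Nat.mod_le ((schedule (2 ^ b) Q D t).flight p).delay (2 ^ (e + 1))
    have h3 := H.start_add_delay hp
    dsimp only [Nat.succ_eq_add_one] at h1 h3
    omega
  rcases h with ⟨-, h | ⟨e, h1, h4, h5, h2, h3⟩⟩ <;>
    rcases h' with ⟨-, h' | ⟨e', h1', h4', h5', h2', h3'⟩⟩
  · omega
  · have := key _ h4' h5' e' h2'
    omega
  · have := key _ h4 h5 e h2
    omega
  · rw [h1, h1', eq_of_mod_two_pow_eq h2 h2' (by omega)]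

theorem port_of_uses {f : Flight} {k : Cluster J} (h : f.Uses k) : f.port = 14 + index k := by
  simp only [Flight.Uses] at h
  simp only [Flight.port, h.1, Nat.add_eq_zero_iff, one_ne_zero, and_false, if_false, index, h.2]
  omega

theorem clusterOut_right (H : Run b J Q D arrived departure loss) (t : ℕ) (k : Cluster J)
    {x x' : ℕ × Flight} {o : ℕ} (h : (snapshot b Q D arrived departure loss t).ClusterOut k x o)
    (h' : (snapshot b Q D arrived departure loss t).ClusterOut k x' o) : x = x' := by
  obtain ⟨p, f⟩ := x
  obtain ⟨p', f'⟩ := x'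
  simp only [Snapshot.ClusterOut, snapshot] at h h'
  rcases h with ⟨hk, ⟨h0, h1, rfl, h2⟩ | ⟨e, h0, h1, rfl, h2, h3⟩⟩ <;>
    rcases h' with ⟨hk', ⟨h0', h1', rfl, h2'⟩ | ⟨e', h0', h1', rfl, h2', h3'⟩⟩
  · obtain rfl := H.eq_of_port_eq_of_out_eq h1 h1'
      ((port_of_uses hk).trans (port_of_uses hk').symm) (h2.trans h2'.symm)
    rfl
  · omega
  · omega
  · obtain rfl : e = e' := by omega
    obtain rfl := H.cluster_unique h1 h1' hk hk' (h3.symm.trans h3')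
    rfl

/-! ### Nothing gets stuck -/

theorem exists_uses (H : Run b J Q D arrived departure loss) {t p : ℕ} (hp : p ∈ Q t)
    (h : ((schedule (2 ^ b) Q D t).flight p).cls ≠ 0) : ∃ k : Cluster J, ((schedule (2 ^ b) Q D t).flight p).Uses k := by
  have hJ := (H.valid t).cls_le p hp
  exact ⟨⟨⟨((schedule (2 ^ b) Q D t).flight p).cls - 1, by omega⟩,
    ⟨((schedule (2 ^ b) Q D t).flight p).pos % 48, Nat.mod_lt _ (by norm_num)⟩⟩,
    by simp only; omega, rfl⟩

theorem index_lt (k : Cluster J) : index k < 48 * J := by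
  obtain ⟨⟨j, hj⟩, ⟨q, hq⟩⟩ := k
  simp only [index]
  omega

theorem port_lt (H : Run b J Q D arrived departure loss) {t p : ℕ} (hp : p ∈ Q t) :
    ((schedule (2 ^ b) Q D t).flight p).port < 14 + 48 * J := by
  by_cases h : ((schedule (2 ^ b) Q D t).flight p).cls = 0
  · have := (H.valid t).pos_lt_of_zero p hp h
    simp only [Flight.port, h, if_true]
    omega
  · obtain ⟨k, hk⟩ := H.exists_uses hp h
    rw [port_of_uses hk]
    have := index_lt k
    omega

theorem exists_mainOut (H : Run b J Q D arrived departure loss) {t p i : ℕ}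
    (h : (snapshot b Q D arrived departure loss t).MainIn p i) : ∃ o < 16 + 48 * J, (snapshot b Q D arrived departure loss t).MainOut p o := by
  simp only [Snapshot.MainIn, Snapshot.MainOut, snapshot] at h ⊢
  by_cases hp : p ∈ Q (t + 1)
  · have hs := (H.start_eq_iff hp).2 (h.imp (fun h => h.2.1) fun h => ⟨h.1, h.2.1⟩)
    have := H.port_lt hp
    exact ⟨_, by omega, Or.inr (Or.inr ⟨hp, hs, rfl⟩)⟩
  · rcases H.ended t p (h.symm.imp (fun h => h.1) fun h => h.2) hp with h | h
    · exact ⟨0, by omega, Or.inl ⟨h, rfl⟩⟩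
    · exact ⟨1, by omega, Or.inr (Or.inl ⟨h, rfl⟩)⟩

theorem exists_mainIn (H : Run b J Q D arrived departure loss) {t p o : ℕ}
    (h : (snapshot b Q D arrived departure loss t).MainOut p o) : ∃ i < 16 + 48 * J, (snapshot b Q D arrived departure loss t).MainIn p i := by
  simp only [Snapshot.MainIn, Snapshot.MainOut, snapshot] at h ⊢
  have key : p ∈ Q t ∧ ((schedule (2 ^ b) Q D t).flight p).out = t ∨ p = t ∧ arrived t = true := by
    rcases h with h | h | h
    · obtain ⟨h1, -, h2⟩ := H.of_departure t p h.1
      exact h2.imp_left fun h => ⟨h, H.out_of_ended h h1⟩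
    · obtain ⟨h1, -, h2⟩ := H.of_loss t p h.1
      exact h2.imp_left fun h => ⟨h, H.out_of_ended h h1⟩
    · rcases (H.start_eq_iff h.1).1 h.2.1 with rfl | h'
      · exact Or.inr ⟨rfl, H.arrived_of_mem _ h.1⟩
      · exact Or.inl h'
  rcases key with h | h
  · have := H.port_lt h.1
    exact ⟨_, by omega, Or.inr ⟨h.1, h.2, rfl⟩⟩
  · exact ⟨0, by omega, Or.inl ⟨rfl, h⟩⟩

/-- After each line the packet proceeds to the next set bit of its delay; if none is left, the
elapsed time equals the delay and the flight ends. -/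
theorem exists_clusterOut (H : Run b J Q D arrived departure loss) {t i : ℕ} {k : Cluster J}
    {x : ℕ × Flight} (h : (snapshot b Q D arrived departure loss t).ClusterIn k x i) :
    ∃ o < width b k + 1, (snapshot b Q D arrived departure loss t).ClusterOut k x o := by
  obtain ⟨p, f⟩ := x
  simp only [Snapshot.ClusterIn, Snapshot.ClusterOut, snapshot] at h ⊢
  rcases h with ⟨hk, ⟨-, h1, rfl, h2⟩ | ⟨e, -, h1, rfl, h2, h3⟩⟩
  · have hpos := H.delay_pos h1
    have hlt := H.delay_lt_width h1 hk
    obtain ⟨e, he, hb, h'⟩ := exists_next_testBit (s := 0) (e := width b k)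
      (x := ((schedule (2 ^ b) Q D (t + 1)).flight p).delay)
      (by rw [pow_zero, Nat.mod_one, Nat.mod_eq_of_lt hlt]; exact hpos)
    rw [pow_zero, Nat.mod_one] at h'
    exact ⟨e + 1, by omega, hk, Or.inr ⟨e, rfl, h1, rfl, hb, by omega⟩⟩
  · have hle := (H.valid t).le_out p h1
    have hlt := H.delay_lt_width h1 hk
    have hsum := H.start_add_delay h1
    rcases hle.eq_or_lt with ho | ho
    · exact ⟨0, by omega, hk, Or.inl ⟨rfl, h1, rfl, ho.symm⟩⟩
    · obtain ⟨e', he, hb, h'⟩ := exists_next_testBit (s := e + 1) (e := width b k)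
        (x := ((schedule (2 ^ b) Q D t).flight p).delay)
        (by rw [Nat.mod_eq_of_lt hlt]; omega)
      obtain ⟨h4, h5⟩ := H.succ_of_lt_out h1 ho
      exact ⟨e' + 1, by omega, hk, Or.inr ⟨e', rfl, h4, h5, hb, by omega⟩⟩

/-- A packet that leaves the element has a previous set bit because its delay is positive; a packet
entering a line comes from the main switch exactly when no lower bit is set. -/
theorem exists_clusterIn (H : Run b J Q D arrived departure loss) {t o : ℕ} {k : Cluster J}
    {x : ℕ × Flight} (h : (snapshot b Q D arrived departure loss t).ClusterOut k x o) :
    ∃ i < width b k + 1, (snapshot b Q D arrived departure loss t).ClusterIn k x i := by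
  obtain ⟨p, f⟩ := x
  simp only [Snapshot.ClusterIn, Snapshot.ClusterOut, snapshot] at h ⊢
  rcases h with ⟨hk, ⟨-, h1, rfl, h2⟩ | ⟨e, -, h1, rfl, h2, h3⟩⟩
  · have hpos := H.delay_pos h1
    have hlt := H.delay_lt_width h1 hk
    have hsum := H.start_add_delay h1
    obtain ⟨e, he, hb, h'⟩ := exists_previous_testBit (s := width b k)
      (x := ((schedule (2 ^ b) Q D t).flight p).delay)
      (by rw [Nat.mod_eq_of_lt hlt]; exact hpos)
    rw [Nat.mod_eq_of_lt hlt] at h'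
    exact ⟨e + 1, by omega, hk, Or.inr ⟨e, rfl, h1, rfl, hb, by omega⟩⟩
  · have he := H.lt_width_of_testBit h1 hk h2
    rcases Nat.eq_zero_or_pos (((schedule (2 ^ b) Q D (t + 1)).flight p).delay % 2 ^ e) with h0 | h0
    · exact ⟨0, by omega, hk, Or.inl ⟨rfl, h1, rfl, by omega⟩⟩
    · obtain ⟨e', he', hb, h'⟩ := exists_previous_testBit h0
      obtain ⟨h4, h5, -⟩ := H.pred_of_start_lt h1 (by omega)
      exact ⟨e' + 1, by omega, hk, Or.inr ⟨e', rfl, h4, h5, hb, by omega⟩⟩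

end Run

end PriorityQueueNetwork

/-! ## The packets follow the schedule -/

namespace PriorityQueueNetwork

namespace Run

variable {b J : ℕ} {Q : ℕ → Finset ℕ} {D : ℕ → ℕ → ℕ} {arrived : ℕ → Bool}
  {departure loss : ℕ → Option ℕ}

/-- Packet `p` is supposed to be at the given outlet in slot `t`. -/
def Expected (b J M r : ℕ) (R : Multiset ℕ) (Q : ℕ → Finset ℕ) (D : ℕ → ℕ → ℕ)
    (arrived : ℕ → Bool) (departure loss : ℕ → Option ℕ) (t : ℕ) :
    Outlet (SwitchIndex J R) (switchSize b J M R) (LineIndex b J r) → ℕ → Prop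
  | .input, p => p = t ∧ arrived t = true
  | .ofSwitch none o, p => (snapshot b Q D arrived departure loss t).MainOut p o.val
  | .ofSwitch (some (.inl k)) o, p =>
    ∃ f, (snapshot b Q D arrived departure loss t).ClusterOut k (p, f) o.val
  | .ofSwitch (some (.inr _)) _, _ => False
  | .ofLine (.inl n), p => p ∈ Q t ∧ ((schedule (2 ^ b) Q D t).flight p).cls = 0 ∧
      ((schedule (2 ^ b) Q D t).flight p).pos = n
  | .ofLine (.inr (.inl ⟨k, s⟩)), p =>
    ∃ f, (snapshot b Q D arrived departure loss t).ClusterIn k (p, f) (s.val + 1)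
  | .ofLine (.inr (.inr _)), _ => False

variable {M r : ℕ} {R : Multiset ℕ}

theorem route_main (H : Run b J Q D arrived departure loss) {t p : ℕ}
    {i o : Fin (switchSize b J M R none)}
    (hi : (snapshot b Q D arrived departure loss t).MainIn p i.val)
    (ho : (snapshot b Q D arrived departure loss t).MainOut p o.val) :
    (snapshot b Q D arrived departure loss t).setting b J M r R none i = o :=
  routingPerm_spec (I := (snapshot b Q D arrived departure loss t).MainIn)
    (O := (snapshot b Q D arrived departure loss t).MainOut) (fun _ _ _ => H.mainIn_left t) (fun _ _ _ => H.mainIn_right t)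
    (fun _ _ _ => H.mainOut_left t) (fun _ _ _ => H.mainOut_right t) hi ho

theorem route_cluster (H : Run b J Q D arrived departure loss) {t : ℕ} {x : ℕ × Flight}
    {k : Cluster J} {i o : Fin (switchSize b J M R (some (.inl k)))}
    (hi : (snapshot b Q D arrived departure loss t).ClusterIn k x i.val)
    (ho : (snapshot b Q D arrived departure loss t).ClusterOut k x o.val) :
    (snapshot b Q D arrived departure loss t).setting b J M r R (some (.inl k)) i = o :=
  routingPerm_spec (I := (snapshot b Q D arrived departure loss t).ClusterIn k)
    (O := (snapshot b Q D arrived departure loss t).ClusterOut k) (fun _ _ _ => clusterIn_left t k) (fun _ _ _ => H.clusterIn_right t k)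
    (fun _ _ _ => H.clusterOut_left t k) (fun _ _ _ => H.clusterOut_right t k) hi ho

theorem main_forward (H : Run b J Q D arrived departure loss) (hM : 16 + 48 * J ≤ M) {t p : ℕ}
    {i : Fin (switchSize b J M R none)}
    (hi : (snapshot b Q D arrived departure loss t).MainIn p i.val) :
    Expected b J M r R Q D arrived departure loss t
      (.ofSwitch none ((snapshot b Q D arrived departure loss t).setting b J M r R none i)) p := by
  obtain ⟨o, ho, h⟩ := H.exists_mainOut hi
  rw [H.route_main hi (o := ⟨o, ho.trans_le hM⟩) h]
  exact h

theorem cluster_forward (H : Run b J Q D arrived departure loss) {t p : ℕ} {f : Flight}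
    {k : Cluster J} {i : Fin (switchSize b J M R (some (.inl k)))}
    (hi : (snapshot b Q D arrived departure loss t).ClusterIn k (p, f) i.val) :
    Expected b J M r R Q D arrived departure loss t (.ofSwitch (some (.inl k))
      ((snapshot b Q D arrived departure loss t).setting b J M r R (some (.inl k)) i)) p := by
  obtain ⟨o, ho, h⟩ := H.exists_clusterOut hi
  rw [H.route_cluster hi (o := ⟨o, ho.trans_le (Nat.le_add_right _ _)⟩) h]
  exact ⟨f, h⟩

theorem uses_of_port_eq (H : Run b J Q D arrived departure loss) {t p : ℕ} (hp : p ∈ Q t)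
    {k : Cluster J} (h : ((schedule (2 ^ b) Q D t).flight p).port = 14 + index k) :
    ((schedule (2 ^ b) Q D t).flight p).Uses k := by
  have hcls : ((schedule (2 ^ b) Q D t).flight p).cls ≠ 0 := by
    intro h0
    have := (H.valid t).pos_lt_of_zero p hp h0
    rw [Flight.port, if_pos h0] at h
    omega
  obtain ⟨l, hl⟩ := H.exists_uses hp hcls
  rw [port_of_uses hl] at h
  rwa [← index_inj (Nat.add_left_cancel h)]

theorem cls_eq_zero_of_port_eq {t p n : ℕ} (hn : n < 14) (h : ((schedule (2 ^ b) Q D t).flight p).port = n) :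
    ((schedule (2 ^ b) Q D t).flight p).cls = 0 ∧
      ((schedule (2 ^ b) Q D t).flight p).pos = n := by
  rw [Flight.port] at h
  split_ifs at h with h0
  · exact ⟨h0, h⟩
  · omega

/-- Bit `s` is set, so spending `2 ^ s` slots in the line moves the elapsed time to the next partial
sum. This is at most the delay, so the flight is still current. -/
theorem clusterIn_of_clusterOut (H : Run b J Q D arrived departure loss) {t p s : ℕ}
    {f : Flight} {k : Cluster J}
    (h : (snapshot b Q D arrived departure loss t).ClusterOut k (p, f) (s + 1)) :
    (snapshot b Q D arrived departure loss (t + 2 ^ s)).ClusterIn k (p, f) (s + 1) := by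
  simp only [Snapshot.ClusterIn, Snapshot.ClusterOut, snapshot] at h ⊢
  rcases h with ⟨hk, ⟨h0, -⟩ | ⟨e, he, h1, rfl, h2, h3⟩⟩
  · omega
  · obtain rfl : e = s := by omega
    have hpow := Nat.two_pow_pos e
    have hle := Nat.mod_le ((schedule (2 ^ b) Q D (t + 1)).flight p).delay (2 ^ (e + 1))
    have hsum := H.start_add_delay h1
    have htime : t + 2 ^ e = ((schedule (2 ^ b) Q D (t + 1)).flight p).start +
        ((schedule (2 ^ b) Q D (t + 1)).flight p).delay % 2 ^ (e + 1) := by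
      rw [mod_two_pow_succ_of_testBit h2]
      omega
    obtain ⟨h4, h5⟩ := H.forward h1 (t := t + 2 ^ e) (by omega) (by omega)
    exact ⟨hk, Or.inr ⟨e, rfl, h4, h5, h2, htime⟩⟩

theorem clusterOut_of_clusterIn (H : Run b J Q D arrived departure loss) {t p s : ℕ}
    {f : Flight} {k : Cluster J}
    (h : (snapshot b Q D arrived departure loss t).ClusterIn k (p, f) (s + 1)) :
    ∃ u, t = u + 2 ^ s ∧
      (snapshot b Q D arrived departure loss u).ClusterOut k (p, f) (s + 1) := by
  simp only [Snapshot.ClusterIn, Snapshot.ClusterOut, snapshot] at h ⊢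
  rcases h with ⟨hk, ⟨h0, -⟩ | ⟨e, he, h1, rfl, h2, h3⟩⟩
  · omega
  · obtain rfl : e = s := by omega
    rw [mod_two_pow_succ_of_testBit h2] at h3
    have hpow := Nat.two_pow_pos e
    obtain ⟨h4, h5⟩ := H.backward h1 (s := ((schedule (2 ^ b) Q D t).flight p).start +
        ((schedule (2 ^ b) Q D t).flight p).delay % 2 ^ e + 1) (by omega) (by omega)
    exact ⟨_, by omega, hk, Or.inr ⟨e, rfl, h4, h5, h2, rfl⟩⟩

/-- Along each link, what is expected at its beginning is what the input relation at its end
requires; the switch settings and the delays then carry this to the next outlet. -/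
theorem expected_of_at {α : Type*} {arr : ℕ → Option α}
    {σ : ℕ → (network b J M r R).Setting} (H : Run b J Q D arrived departure loss)
    (hM : 16 + 48 * J ≤ M) (ha : ∀ t, arrived t = (arr t).isSome)
    (hσ : ∀ t, σ t = (snapshot b Q D arrived departure loss t).setting b J M r R) {t p : ℕ}
    {y : Outlet (network b J M r R).Switch (network b J M r R).size (network b J M r R).Line}
    (h : (network b J M r R).At σ arr t y p) :
    Expected b J M r R Q D arrived departure loss t y p := by
  induction h with
  | arrival t h => exact ⟨rfl, (ha t).trans h⟩
  | switch t p k i x hw hx ih =>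
    rw [hσ]
    cases network_wire.1 hw with
    | arrival i hi =>
      exact H.main_forward hM (Or.inl ⟨hi, ih⟩)
    | shortOut n i hi =>
      obtain ⟨h1, h2, h3⟩ := ih
      have ho := (H.valid t).le_out p h1
      have hs := (H.valid t).start_lt p h1
      refine H.main_forward hM (Or.inr ⟨h1, ?_, ?_⟩)
      · simp only [Flight.out, h2, if_true, snapshot] at ho ⊢
        omega
      · simp only [snapshot, Flight.port, h2, if_true]
        omega
    | clusterIn k o i ho hi =>
      rcases ih with ⟨-, h⟩ | ⟨-, h⟩ | ⟨h1, h2, h3⟩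
      · omega
      · omega
      · have h4 : ((schedule (2 ^ b) Q D (t + 1)).flight p).port = 14 + index k := by
          simp only [snapshot] at h3
          omega
        exact H.cluster_forward ⟨H.uses_of_port_eq h1 h4, Or.inl ⟨hi, h1, rfl, h2⟩⟩
    | clusterOut k o i ho hi =>
      obtain ⟨f, hk, ⟨-, h1, h2, h3⟩ | ⟨e, he, -⟩⟩ := ih
      · simp only [snapshot] at h1 h2 h3
        subst h2
        refine H.main_forward hM (Or.inr ⟨h1, h3, ?_⟩)
        simp only [snapshot]
        rw [port_of_uses hk]
        omega
      · omega
    | lineOut k s i hi =>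
      obtain ⟨f, h⟩ := ih
      rw [← hi] at h
      exact H.cluster_forward h
  | line t p e x hw hx ih =>
    cases network_wire.1 hw with
    | shortIn n o ho =>
      rcases ih with ⟨-, h⟩ | ⟨-, h⟩ | ⟨h1, h2, h3⟩
      · omega
      · omega
      · simp only [snapshot] at h3
        have h4 : ((schedule (2 ^ b) Q D (t + 1)).flight p).port = n := by omega
        exact ⟨h1, cls_eq_zero_of_port_eq n.isLt h4⟩
    | lineIn k s o ho =>
      obtain ⟨f, h⟩ := ih
      rw [ho] at h
      exact ⟨f, H.clusterIn_of_clusterOut h⟩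

/-- Switches are traversed within a slot, and the main switch and the elements feed each other, so
induction on time alone is not enough. Inside a slot the order is: lines, outputs 0 of the elements,
main switch, remaining outputs of the elements. There is no circle, since delays are positive and a
packet at output 0 comes from a line (`hzero`). -/
theorem at_of_expected {α : Type*} {arr : ℕ → Option α}
    {σ : ℕ → (network b J M r R).Setting} (H : Run b J Q D arrived departure loss)
    (hM : 16 + 48 * J ≤ M) (ha : ∀ t, arrived t = (arr t).isSome)
    (hσ : ∀ t, σ t = (snapshot b Q D arrived departure loss t).setting b J M r R) {t p : ℕ}
    {y : Outlet (SwitchIndex J R) (switchSize b J M R) (LineIndex b J r)}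
    (h : Expected b J M r R Q D arrived departure loss t y p) :
    (network b J M r R).At σ arr t y p := by
  induction t using Nat.strong_induction_on generalizing y p with
  | _ t ih =>
  have hline : ∀ e p, Expected b J M r R Q D arrived departure loss t (.ofLine e) p →
      (network b J M r R).At σ arr t (.ofLine e) p := by
    rintro (n | ⟨k, s⟩ | e) p h
    · obtain ⟨h1, h2, h3⟩ := h
      have ho := (H.valid t).le_out p h1
      have hs := (H.valid t).start_lt p h1
      simp only [Flight.out, h2, if_true] at ho
      obtain ⟨u, rfl⟩ : ∃ u, t = u + 1 := ⟨t - 1, by omega⟩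
      have hn : 2 + n.val < switchSize b J M R none := by
        have := n.isLt
        simp only [switchSize]
        omega
      have hx : (network b J M r R).At σ arr u (.ofSwitch none ⟨2 + n.val, hn⟩) p := by
        refine ih u u.lt_succ_self (Or.inr (Or.inr ⟨h1, ?_, ?_⟩))
        · simp only [snapshot]
          omega
        · simp only [snapshot, Flight.port, h2, if_true, h3]
      exact SDLNetwork.At.line u p (Sum.inl n) _ (network_wire.2 (Link.shortIn n ⟨_, hn⟩ rfl)) hx
    · obtain ⟨f, h⟩ := h
      obtain ⟨u, rfl, h'⟩ := H.clusterOut_of_clusterIn h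
      have hn : s.val + 1 < switchSize b J M R (some (.inl k)) := by
        have := s.isLt
        simp only [switchSize]
        omega
      have hx : (network b J M r R).At σ arr u (.ofSwitch (some (.inl k)) ⟨s.val + 1, hn⟩) p :=
        ih u (Nat.lt_add_of_pos_right (Nat.two_pow_pos _)) ⟨f, h'⟩
      exact SDLNetwork.At.line u p (Sum.inr (Sum.inl ⟨k, s⟩)) _
        (network_wire.2 (Link.lineIn k s ⟨_, hn⟩ rfl)) hx
    · exact h.elim
  have hstep : ∀ (k : SwitchIndex J R) (i o : Fin (switchSize b J M R k)) x p,
      Link b J M r R x (.toSwitch k i) → (network b J M r R).At σ arr t x p →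
      (snapshot b Q D arrived departure loss t).setting b J M r R k i = o →
      (network b J M r R).At σ arr t (.ofSwitch k o) p := by
    intro k i o x p hl hx he
    have := SDLNetwork.At.switch (N := network b J M r R) t p k i x (network_wire.2 hl) hx
    rw [hσ, he] at this
    exact this
  have hfed : ∀ (k : Cluster J) (i o : Fin (switchSize b J M R (some (.inl k)))) p f,
      (snapshot b Q D arrived departure loss t).ClusterIn k (p, f) i.val →
      (snapshot b Q D arrived departure loss t).ClusterOut k (p, f) o.val → i.val ≠ 0 →
      (network b J M r R).At σ arr t (.ofSwitch (some (.inl k)) o) p := by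
    intro k i o p f hi ho h0
    have hroute := H.route_cluster (r := r) hi ho
    have hi' := hi
    obtain ⟨hk, ⟨h, -⟩ | ⟨e, he, h1, h2, h3, -⟩⟩ := hi
    · exact absurd h h0
    · simp only [snapshot] at h1 h2
      subst h2
      have hw := H.lt_width_of_testBit h1 hk h3
      rw [he] at hi'
      exact hstep _ i o _ p (Link.lineOut k ⟨e, hw⟩ i he) (hline (.inr (.inl ⟨k, ⟨e, hw⟩⟩)) p ⟨_, hi'⟩)
        hroute
  have hzero : ∀ (k : Cluster J) (o : Fin (switchSize b J M R (some (.inl k)))) p,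
      Expected b J M r R Q D arrived departure loss t (.ofSwitch (some (.inl k)) o) p →
      o.val = 0 → (network b J M r R).At σ arr t (.ofSwitch (some (.inl k)) o) p := by
    rintro k o p ⟨f, ho⟩ h0
    obtain ⟨i, hlt, hi⟩ := H.exists_clusterIn ho
    refine hfed k ⟨i, hlt.trans_le (Nat.le_add_right _ _)⟩ o p f hi ho ?_
    rintro h
    dsimp only at h
    simp only [Snapshot.ClusterIn, Snapshot.ClusterOut, snapshot] at hi ho
    obtain ⟨-, ⟨-, h1, rfl, h2⟩ | ⟨e, he, -⟩⟩ := hi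
    · obtain ⟨-, ⟨-, -, -, h3⟩ | ⟨e, he, -⟩⟩ := ho
      · have := H.start_lt_out h1
        omega
      · omega
    · omega
  have hmain : ∀ (o : Fin (switchSize b J M R none)) p,
      Expected b J M r R Q D arrived departure loss t (.ofSwitch none o) p →
      (network b J M r R).At σ arr t (.ofSwitch none o) p := by
    intro o p ho
    obtain ⟨i, hlt, hi⟩ := H.exists_mainIn ho
    have hroute := H.route_main (R := R) (r := r) (i := ⟨i, hlt.trans_le hM⟩) hi ho
    rcases hi with ⟨h0, h1, h2⟩ | ⟨h1, h2, h3⟩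
    · rw [show p = t from h1]
      exact hstep none ⟨i, hlt.trans_le hM⟩ o _ _ (Link.arrival _ h0)
        (SDLNetwork.At.arrival t ((ha t).symm.trans h2)) hroute
    · simp only [snapshot] at h1 h2 h3
      by_cases hc : ((schedule (2 ^ b) Q D t).flight p).cls = 0
      · have hn := (H.valid t).pos_lt_of_zero p h1 hc
        refine hstep none ⟨i, hlt.trans_le hM⟩ o _ _ (Link.shortOut ⟨_, hn⟩ _ ?_)
          (hline (.inl ⟨_, hn⟩) p ⟨h1, hc, rfl⟩) hroute
        show i = _
        rw [h3, Flight.port, if_pos hc]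
      · obtain ⟨k, hk⟩ := H.exists_uses h1 hc
        refine hstep none ⟨i, hlt.trans_le hM⟩ o _ _
          (Link.clusterOut k ⟨0, Nat.lt_of_lt_of_le (Nat.succ_pos _) (Nat.le_add_right _ _)⟩ _ rfl ?_)
          (hzero k _ p ⟨_, hk, Or.inl ⟨rfl, h1, rfl, h2⟩⟩ rfl) hroute
        show i = _
        rw [h3, port_of_uses hk]
        omega
  have hcluster : ∀ (k : Cluster J) (o : Fin (switchSize b J M R (some (.inl k)))) p,
      Expected b J M r R Q D arrived departure loss t (.ofSwitch (some (.inl k)) o) p →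
      (network b J M r R).At σ arr t (.ofSwitch (some (.inl k)) o) p := by
    rintro k o p ⟨f, ho⟩
    obtain ⟨i, hlt, hi⟩ := H.exists_clusterIn ho
    have hlt' : i < switchSize b J M R (some (.inl k)) := hlt.trans_le (Nat.le_add_right _ _)
    by_cases h0 : i = 0
    · have hroute := H.route_cluster (r := r) (i := ⟨i, hlt'⟩) hi ho
      obtain ⟨hk, ⟨-, h1, h2, h3⟩ | ⟨e, he, -⟩⟩ := hi
      · simp only [snapshot] at h1 h2 h3
        subst h2
        have hn : 16 + index k < switchSize b J M R none := by
          have := index_lt k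
          simp only [switchSize]
          omega
        refine hstep _ ⟨i, hlt'⟩ o _ p (Link.clusterIn k ⟨16 + index k, hn⟩ _ rfl h0)
          (hmain _ p (Or.inr (Or.inr ⟨h1, h3, ?_⟩))) hroute
        simp only [snapshot]
        rw [port_of_uses hk]
        omega
      · omega
    · exact hfed k ⟨i, hlt'⟩ o p f hi ho h0
  rcases y with _ | ⟨k, o⟩ | e
  · obtain ⟨rfl, h⟩ := h
    exact SDLNetwork.At.arrival _ ((ha _).symm.trans h)
  · rcases k with _ | k | k
    · exact hmain o p h
    · exact hcluster k o p h
    · exact h.elim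
  · exact hline e p h

end Run

end PriorityQueueNetwork

/-! ## The network as a priority queue -/

namespace PriorityQueueNetwork

section Policy

variable {α : Type u} [LinearOrder α]

/-- The snapshot of the run of the ideal priority queue. -/
noncomputable def idealSnapshot (b B : ℕ) (arr : ℕ → Option α) (req : ℕ → Bool) (t : ℕ) :
    Snapshot :=
  snapshot b (queue arr req B) (fun t => depth arr B (queue arr req B t))
    (fun t => (arr t).isSome) (idealTrace arr req B).departure (idealTrace arr req B).loss t

/-- Causality: a snapshot includes the queue and the flights after slot `t`, but these depend only
on arrivals and requests up to `t`. -/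
theorem idealSnapshot_congr {arr arr' : ℕ → Option α} {req req' : ℕ → Bool} {t : ℕ}
    (ha : ∀ s ≤ t, arr s = arr' s) (hr : ∀ s ≤ t, req s = req' s) (b B : ℕ) :
    idealSnapshot b B arr req t = idealSnapshot b B arr' req' t := by
  have hQ : ∀ s ≤ t + 1, queue arr req B s = queue arr' req' B s := fun s hs =>
    queue_congr (fun u hu => ha u (by omega)) (fun u hu => hr u (by omega)) B
  have hD : ∀ s ≤ t + 1, (fun s => depth arr B (queue arr req B s)) s =
      (fun s => depth arr' B (queue arr' req' B s)) s := by
    intro s hs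
    funext p
    simp only [depth, hQ s hs]
    split_ifs with hp
    · rw [rankIn_congr (fun q hq => ha q ?_) hp]
      have := lt_of_mem_queue hq
      omega
    · rfl
  have hS : ∀ s ≤ t + 1, schedule (2 ^ b) (queue arr req B)
      (fun t => depth arr B (queue arr req B t)) s = schedule (2 ^ b) (queue arr' req' B)
      (fun t => depth arr' B (queue arr' req' B t)) s := fun s hs =>
    schedule_congr (fun u hu => hQ u (by omega)) (fun u hu => hD u (by omega))
  have hP : withArrival arr t (queue arr' req' B t) = withArrival arr' t (queue arr' req' B t) := by
    rw [withArrival, withArrival, ha t le_rfl]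
  have hsel : ∀ n, select arr (withArrival arr' t (queue arr' req' B t)) n =
      select arr' (withArrival arr' t (queue arr' req' B t)) n := by
    refine select_congr fun p hp => ?_
    rcases mem_withArrival.1 hp with h | h
    · exact ha p (lt_of_mem_queue h).le
    · exact ha p h.1.le
  simp only [idealSnapshot, snapshot, idealTrace, served, dropped, hP, hsel, hS t (by omega),
    hS (t + 1) le_rfl, hQ t (by omega), hQ (t + 1) le_rfl, ha t le_rfl, hr t le_rfl]

/-- The routing policy: all switches are set as prescribed by the schedule. -/
noncomputable def policy (α : Type u) [LinearOrder α] (b B J M r : ℕ) (R : Multiset ℕ) :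
    (network b J M r R).Policy α := fun t hist =>
  (idealSnapshot b B (fun s => if h : s < t + 1 then (hist ⟨s, h⟩).1 else none)
    (fun s => if h : s < t + 1 then (hist ⟨s, h⟩).2 else false) t).setting b J M r R

/-- The policy completes the history by default values for the future; by `idealSnapshot_congr` they
have no influence. -/
theorem policy_settings (b B J M r : ℕ) (R : Multiset ℕ) (arr : ℕ → Option α) (req : ℕ → Bool)
    (t : ℕ) : (policy α b B J M r R).settings arr req t =
      (idealSnapshot b B arr req t).setting b J M r R := by
  simp only [SDLNetwork.Policy.settings, policy]
  congr 1
  refine idealSnapshot_congr (fun s hs => ?_) (fun s hs => ?_) b B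
  · rw [dif_pos (Nat.lt_succ_of_le hs)]
  · rw [dif_pos (Nat.lt_succ_of_le hs)]

theorem run_ideal {b B J : ℕ} (hb : b ≤ 1) (hB : B + 1 < 2 * (2 ^ b * 4 ^ (J + 1)))
    {arr : ℕ → Option α} (req : ℕ → Bool)
    (hdist : ∀ s t x, arr s = some x → arr t = some x → s = t) :
    Run b J (queue arr req B) (fun t => depth arr B (queue arr req B t))
      (fun t => (arr t).isSome) (idealTrace arr req B).departure (idealTrace arr req B).loss where
  toDepthProcess := depthProcess_queue hdist req (by positivity)
    (by simpa using Nat.pow_le_pow_right two_pos hb) hB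
  arrived_of_mem t h := isSome_of_mem_queue h
  ended t p h h' := by
    by_contra hne
    rw [not_or] at hne
    exact h' (Finset.mem_filter.2 ⟨mem_withArrival.2 h, hne.1, hne.2⟩)
  of_departure t p h := by
    refine ⟨fun h' => (Finset.mem_filter.1 h').2.1 h, fun h' => ?_, ?_⟩
    · simp only [idealTrace, served, dropped] at h h'
      split_ifs at h h'
    · simp only [idealTrace, served] at h
      split_ifs at h
      exact mem_withArrival.1 (mem_of_select h).1
  of_loss t p h := by
    refine ⟨fun h' => (Finset.mem_filter.1 h').2.2 h, fun h' => ?_, ?_⟩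
    · simp only [idealTrace, served, dropped] at h h'
      split_ifs at h h'
    · simp only [idealTrace, dropped] at h
      split_ifs at h
      exact mem_withArrival.1 (mem_of_select h).1

/-- Since `Expected` describes exactly where packets are, the two external links can be read off
from the main switch, and the stored packets from the lines that are occupied. -/
theorem network_trace {b B J M r : ℕ} {R : Multiset ℕ} (hb : b ≤ 1)
    (hB : B + 1 < 2 * (2 ^ b * 4 ^ (J + 1))) (hM : 16 + 48 * J ≤ M) {arr : ℕ → Option α}
    (req : ℕ → Bool) (hdist : ∀ s t x, arr s = some x → arr t = some x → s = t) :
    (network b J M r R).trace ((policy α b B J M r R).settings arr req) arr req =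
      idealTrace arr req B := by
  have H := run_ideal hb hB req hdist
  have hat : ∀ t (y : Outlet (SwitchIndex J R) (switchSize b J M R) (LineIndex b J r)) p,
      (network b J M r R).At ((policy α b B J M r R).settings arr req) arr t y p ↔
        Run.Expected b J M r R (queue arr req B) (fun t => depth arr B (queue arr req B t))
          (fun t => (arr t).isSome) (idealTrace arr req B).departure (idealTrace arr req B).loss
          t y p := fun t y p =>
    ⟨H.expected_of_at hM (fun _ => rfl) (policy_settings b B J M r R arr req),
      H.at_of_expected hM (fun _ => rfl) (policy_settings b B J M r R arr req)⟩
  have hrec : ∀ t (y : Inlet (SwitchIndex J R) (switchSize b J M R) (LineIndex b J r)) p,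
      (network b J M r R).Receives ((policy α b B J M r R).settings arr req) arr t y p ↔
        ∃ x, Link b J M r R x y ∧ Run.Expected b J M r R (queue arr req B)
          (fun t => depth arr B (queue arr req B t)) (fun t => (arr t).isSome)
          (idealTrace arr req B).departure (idealTrace arr req B).loss t x p := fun t y p =>
    exists_congr fun x => and_congr network_wire (hat t x p)
  have h0 : 0 < switchSize b J M R none := by simp only [switchSize]; omega
  have h1 : 1 < switchSize b J M R none := by simp only [switchSize]; omega
  have hdep : ∀ t, (network b J M r R).content ((policy α b B J M r R).settings arr req) arr t
      .departure = (idealTrace arr req B).departure t := by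
    intro t
    refine Option.ext fun p => ?_
    rw [SDLNetwork.content_eq_some_iff]
    refine (hrec t .departure p).trans ⟨?_, fun h => ?_⟩
    · rintro ⟨x, hl, hx⟩
      cases hl with
      | departure o ho =>
        rcases hx with ⟨h, -⟩ | ⟨-, h⟩ | ⟨-, -, h⟩
        · exact h
        · omega
        · omega
    · exact ⟨_, Link.departure ⟨0, h0⟩ rfl, Or.inl ⟨h, rfl⟩⟩
  have hloss : ∀ t, (network b J M r R).content ((policy α b B J M r R).settings arr req) arr t
      .loss = (idealTrace arr req B).loss t := by
    intro t
    refine Option.ext fun p => ?_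
    rw [SDLNetwork.content_eq_some_iff]
    refine (hrec t .loss p).trans ⟨?_, fun h => ?_⟩
    · rintro ⟨x, hl, hx⟩
      cases hl with
      | loss o ho =>
        rcases hx with ⟨-, h⟩ | ⟨h, -⟩ | ⟨-, -, h⟩
        · omega
        · exact h
        · omega
    · exact ⟨_, Link.loss ⟨1, h1⟩ rfl, Or.inr (Or.inl ⟨h, rfl⟩)⟩
  have hbuf : ∀ t, (network b J M r R).buffered ((policy α b B J M r R).settings arr req) arr t =
      (queue arr req B t : Set ℕ) := by
    intro t
    ext p
    constructor
    · rintro ⟨e, s, hst, hts, hp⟩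
      obtain ⟨x, hl, hx⟩ := (hrec s (.toLine e) p).1 hp
      cases hl with
      | shortIn n o ho =>
        rcases hx with ⟨-, h⟩ | ⟨-, h⟩ | ⟨h, -, -⟩
        · omega
        · omega
        · change t ≤ s + 1 at hts
          obtain rfl : t = s + 1 := by omega
          exact h
      | lineIn k i o ho =>
        change t ≤ s + 2 ^ i.val at hts
        obtain ⟨f, h⟩ := hx
        rw [ho] at h
        obtain ⟨-, ⟨h, -⟩ | ⟨e, -, h1, h2, -, h3⟩⟩ := H.clusterIn_of_clusterOut h
        · omega
        · simp only [snapshot] at h1 h2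
          subst h2
          obtain ⟨-, ⟨h', -⟩ | ⟨e, -, h4, h5, -, h6⟩⟩ := h
          · omega
          · simp only [snapshot] at h4 h5 h6
            refine (H.backward h1 hts ?_).1
            omega
    · intro hp
      have hle := (H.valid t).le_out p hp
      have hlt := (H.valid t).start_lt p hp
      by_cases hc : ((schedule (2 ^ b) (queue arr req B)
          (fun t => depth arr B (queue arr req B t)) t).flight p).cls = 0
      · have hn := (H.valid t).pos_lt_of_zero p hp hc
        have hout := hle
        simp only [Flight.out, hc, if_true] at hout
        obtain ⟨s, rfl⟩ : ∃ s, t = s + 1 := ⟨t - 1, by omega⟩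
        refine ⟨(Sum.inl ⟨_, hn⟩ : LineIndex b J r), s, s.lt_succ_self, le_rfl,
          (hrec s (.toLine (.inl ⟨_, hn⟩)) p).2 ⟨_, Link.shortIn ⟨_, hn⟩ ⟨_, ?_⟩ rfl,
            Or.inr (Or.inr ⟨hp, ?_, ?_⟩)⟩⟩
        · simp only [switchSize]
          omega
        · simp only [snapshot]
          omega
        · simp only [snapshot, Flight.port, hc, if_true]
      · obtain ⟨k, hk⟩ := H.exists_uses hp hc
        have hsum := H.start_add_delay hp
        have hw := H.delay_lt_width hp hk
        -- The line holding the packet is found from the elapsed time `t - start`, which lies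
        -- between two consecutive partial sums. The upper one is allowed: a packet emerging in slot
        -- `t` is still stored at its beginning.
        obtain ⟨e, he, hbit, hlo, hhi⟩ := exists_testBit_between (e := width b k)
          (x := ((schedule (2 ^ b) (queue arr req B)
            (fun t => depth arr B (queue arr req B t)) t).flight p).delay)
          (Nat.sub_pos_of_lt hlt) (by rw [Nat.mod_eq_of_lt hw]; omega)
        rw [mod_two_pow_succ_of_testBit hbit] at hhi
        obtain ⟨h4, h5⟩ := H.backward hp (s := ((schedule (2 ^ b) (queue arr req B)
            (fun t => depth arr B (queue arr req B t)) t).flight p).start +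
          ((schedule (2 ^ b) (queue arr req B)
            (fun t => depth arr B (queue arr req B t)) t).flight p).delay % 2 ^ e + 1)
          (by omega) (by omega)
        refine ⟨(Sum.inr (Sum.inl ⟨k, ⟨e, he⟩⟩) : LineIndex b J r), _, ?_, ?_,
          (hrec _ (.toLine (.inr (.inl ⟨k, ⟨e, he⟩⟩))) p).2 ⟨_, Link.lineIn k ⟨e, he⟩
            ⟨e + 1, ?_⟩ rfl, _, hk, Or.inr ⟨e, rfl, h4, h5, hbit, rfl⟩⟩⟩
        · omega
        · change t ≤ _ + 2 ^ e
          omega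
        · simp only [switchSize]
          omega
  simp only [SDLNetwork.trace, idealTrace, QueueTrace.mk.injEq, true_and]
  exact ⟨funext hdep, funext hloss, funext hbuf⟩

theorem network_isPriorityQueue {b B J M r : ℕ} {R : Multiset ℕ} (hb : b ≤ 1)
    (hB : B + 1 < 2 * (2 ^ b * 4 ^ (J + 1))) (hM : 16 + 48 * J ≤ M) :
    SDLNetwork.IsPriorityQueue.{u} (network b J M r R) B := by
  intro α _
  refine ⟨policy α b B J M r R, fun arr req hdist => ?_⟩
  rw [network_trace hb hB hM req hdist]
  exact idealTrace_isPriorityQueue hdist req B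

end Policy

/-! ## Counting the parts -/

/-- The sizes of the switches of the delay elements. -/
def clusterSizes (b J : ℕ) : Multiset ℕ :=
  ∑ k : Cluster J, {width b k + 1 + k.2.val / 24}

theorem map_univ_eq_sum {ι : Type*} [Fintype ι] (f : ι → ℕ) :
    (Finset.univ : Finset ι).val.map f = ∑ i, ({f i} : Multiset ℕ) := by
  rw [Finset.sum, ← Multiset.sum_map_singleton (Finset.univ.val.map f), Multiset.map_map]
  rfl

theorem network_switchSizes (b J M r : ℕ) (R : Multiset ℕ) :
    (network b J M r R).switchSizes = {M} + (clusterSizes b J + R) := by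
  have hR : ∑ x : R.ToType, ({x.1} : Multiset ℕ) = R := by
    rw [← map_univ_eq_sum]
    exact Multiset.map_univ_coe R
  have h : (network b J M r R).switchSizes =
      ∑ k : SwitchIndex J R, ({switchSize b J M R k} : Multiset ℕ) := by
    rw [← map_univ_eq_sum]
    simp only [SDLNetwork.switchSizes]
    congr!
  rw [h, Fintype.sum_option, Fintype.sum_sum_type]
  simp only [switchSize]
  rw [hR, clusterSizes]

/-- The 48 elements of a class split into 24 of each of two consecutive sizes, and the next class
continues with the following two, as widths grow by 2. -/
theorem clusterSizes_eq (b J : ℕ) : clusterSizes b J =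
    ∑ i ∈ Finset.Ico (b + 2) (b + 2 + 2 * J), Multiset.replicate 24 (i + 1) := by
  have hinner : ∀ n : ℕ, ∑ q : Fin 48, ({n + q.val / 24} : Multiset ℕ) =
      Multiset.replicate 24 n + Multiset.replicate 24 (n + 1) := by
    intro n
    rw [Fin.sum_univ_eq_sum_range (fun q => ({n + q / 24} : Multiset ℕ)) (24 + 24),
      Finset.sum_range_add]
    congr 1
  rw [clusterSizes, Fintype.sum_prod_type]
  simp only [width, hinner]
  rw [Fin.sum_univ_eq_sum_range (fun j => Multiset.replicate 24 (2 * (j + 1) + b + 1) +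
    Multiset.replicate 24 (2 * (j + 1) + b + 1 + 1)) J]
  induction J with
  | zero => simp
  | succ J ih =>
    rw [Finset.sum_range_succ, ih, show b + 2 + 2 * (J + 1) = b + 2 + 2 * J + 1 + 1 by ring,
      Finset.sum_Ico_succ_top (by omega), Finset.sum_Ico_succ_top (by omega),
      show 2 * (J + 1) + b + 1 = b + 2 + 2 * J + 1 by ring, ← add_assoc]

theorem sum_width (b J : ℕ) : ∑ k : Cluster J, width b k = 48 * (J * (J + 1) + b * J) := by
  rw [Fintype.sum_prod_type]
  simp only [width, Finset.sum_const, Finset.card_univ, Fintype.card_fin, smul_eq_mul]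
  rw [Fin.sum_univ_eq_sum_range (fun j => 48 * (2 * (j + 1) + b)) J]
  induction J with
  | zero => simp
  | succ J ih => rw [Finset.sum_range_succ, ih]; ring

theorem network_numLines (b J M r : ℕ) (R : Multiset ℕ) :
    (network b J M r R).numLines = 14 + 48 * (J * (J + 1) + b * J) + r := by
  have h : (network b J M r R).numLines = Fintype.card (LineIndex b J r) := by
    simp only [SDLNetwork.numLines]
    congr!
  rw [h, Fintype.card_sum, Fintype.card_sum, Fintype.card_sigma]
  simp only [Fintype.card_fin]
  rw [sum_width, add_assoc]

end PriorityQueueNetwork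

open PriorityQueueNetwork in
theorem mainTheorem2 (m : ℕ) (hm : 1 ≤ m) :
    ∃ N : SDLNetwork,
      N.switchSizes = {32 * m - 14} + Multiset.replicate 48 3
        + ∑ j ∈ Finset.Icc 3 (m - 1), Multiset.replicate 24 (j + 1)
        + Multiset.replicate 12 (m + 1) ∧
      N.numLines = 12 * (m ^ 2 + 3 - 2 * m) ∧
      SDLNetwork.IsPriorityQueue.{u} N (3 * 2 ^ (m - 1) - 2) := by
  -- For `m ≥ 2` the parity of `m` gives `b`, and then `2 ^ b * 4 ^ (J + 1) = 2 ^ m`. For `m = 1`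
  -- truncated subtraction gives `J = 0`: the unit lines alone suffice.
  obtain ⟨b, J, hb, hJ⟩ : ∃ b J, b ≤ 1 ∧ (m = 1 ∧ b = 1 ∧ J = 0 ∨ m = 2 * J + 2 + b) :=
    ⟨m % 2, (m - 2) / 2, by omega, by omega⟩
  -- The elements need only 24 switches of each size from `b + 3` to `m`, so 24 of the size 3 and
  -- the twelve largest are not required.
  have hle : clusterSizes b J ≤ Multiset.replicate 48 3
      + ∑ j ∈ Finset.Icc 3 (m - 1), Multiset.replicate 24 (j + 1)
      + Multiset.replicate 12 (m + 1) := by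
    refine le_trans ?_ (Multiset.le_add_right _ _)
    rw [clusterSizes_eq]
    calc ∑ i ∈ Finset.Ico (b + 2) (b + 2 + 2 * J), Multiset.replicate 24 (i + 1)
        ≤ ∑ i ∈ insert 2 (Finset.Icc 3 (m - 1)), Multiset.replicate 24 (i + 1) := by
          refine Finset.sum_le_sum_of_subset fun i hi => ?_
          rw [Finset.mem_Ico] at hi
          rw [Finset.mem_insert, Finset.mem_Icc]
          omega
      _ = Multiset.replicate 24 3 + ∑ i ∈ Finset.Icc 3 (m - 1), Multiset.replicate 24 (i + 1) :=
          Finset.sum_insert (by simp)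
      _ ≤ _ := by
          gcongr
          norm_num
  -- For `m = 2 * J + 2 + b` the quadratic terms on both sides agree up to a nonnegative remainder,
  -- 22 for `b = 0` and 58 for `b = 1`.
  have hlines : 14 + 48 * (J * (J + 1) + b * J) ≤ 12 * (m ^ 2 + 3 - 2 * m) := by
    rcases hJ with ⟨rfl, rfl, rfl⟩ | rfl
    · norm_num
    · have : (2 * J + 2 + b) ^ 2 + 3 - 2 * (2 * J + 2 + b) =
          4 * (J * J) + 4 * J + 4 * (b * J) + 3 + 2 * b + b * b := by
        refine Nat.sub_eq_of_eq_add ?_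
        ring
      rw [this]
      rcases Nat.le_one_iff_eq_zero_or_eq_one.1 hb with rfl | rfl <;> ring_nf <;> omega
  refine ⟨network b J (32 * m - 14) (12 * (m ^ 2 + 3 - 2 * m) - (14 + 48 * (J * (J + 1) + b * J)))
    (Multiset.replicate 48 3 + ∑ j ∈ Finset.Icc 3 (m - 1), Multiset.replicate 24 (j + 1)
      + Multiset.replicate 12 (m + 1) - clusterSizes b J), ?_, ?_, ?_⟩
  · rw [network_switchSizes, add_tsub_cancel_of_le hle, add_assoc, add_assoc, add_assoc]
  · rw [network_numLines, Nat.add_sub_cancel' hlines]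
  · refine network_isPriorityQueue hb ?_ (by omega)
    rcases hJ with ⟨rfl, rfl, rfl⟩ | rfl
    · norm_num
    -- The classes reach depth `2 ^ m`, and `B + 1 = 3 * 2 ^ (m - 1) - 1` is below `2 * 2 ^ m = 4 *
    -- 2 ^ (m - 1)`.
    · have h : 2 ^ b * 4 ^ (J + 1) = 2 * 2 ^ (2 * J + 2 + b - 1) := by
        rw [show (4 : ℕ) = 2 ^ 2 by norm_num, ← pow_mul, ← pow_add, ← pow_succ']
        congr 1
        omega
      rw [h]
      have := Nat.two_pow_pos (2 * J + 2 + b - 1)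
      omega
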